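/- **Corollary 4.5.** Let $G$ be a nontrivial Carnot group: a simply connected real Lie group whose Lie algebra has a stratification $\mathfrak g=V_1\oplus\cdots\oplus V_s$ with $V_{r+1}=[V_1,V_r]$ for $1\le r\le s$ and $V_{s+1}=0$. As usual, $G$ is identified with $\mathfrak g$ (as a manifold) through the exponential map, which is a diffeomorphism. Let $n_h=\sum_{r=1}^s r\dim V_r\ (\ge 1)$ be its Hausdorff dimension, and let $X_1,\dots,X_k$ be a basis of $V_1$ (orthonormal for the inner product on $V_1$ that it determines), extended to left-invariant vector fields on $G$. For $\phi:G\to\mathbb R^D$ let $\nabla^l\phi=(X_{i_1}\cdots X_{i_l}\phi)_{1\le i_1,\dots,i_l\le k}:G\to\mathbb R^{k^lD}$ be the iterated horizontal gradient, and $\|f\|_{C^0}=\sup_{p\in G}|f(p)|$ with $|\cdot|$ the Euclidean norm. Call $\phi$ horizontally $C^j$ if all $X_{i_1}\cdots X_{i_l}\phi$ with $0\le l\le j$ exist and are continuous on $G$. Let $m\ge 1$, $m'\ge 0$ and $j\ge 1$ be integers. There is a constant $C$, depending only on $G$ (with the basis $X_1,\dots,X_k$), $m$, $m'$ and $j$,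 such that the following holds for every natural number $D$ with $$m\le D-2^{4n_h+7}n_h-m'+1$$ and all positive reals $R_1,\dots,R_j$ with $R_iR_{i'}\ge R_{i+i'}$ whenever $i,i'\ge1$ and $i+i'\le j$. Let $v_1,\dots,v_m:G\to\mathbb S^{D-1}$ be horizontally $C^j$, form an orthonormal system at each point of $G$, and satisfy $$\sum_{l=1}^j R_l\|\nabla^l v_i\|_{C^0}\le 1,\qquad i=1,\dots,m.$$ Then there exist horizontally $C^j$ maps $v_{m+1},\dots,v_{m+m'}:G\to\mathbb S^{D-1}$ such that $v_1,\dots,v_{m+m'}$ form an orthonormal system at each point of $G$, and $$\sum_{l=1}^j R_l\|\nabla^l v_i\|_{C^0}\le C,\qquad i=m+1,\dots,m+m'.$$ Moreover, for every $r\in\{0,1,2,\dots\}\cup\{\infty\}$ for which $v_1,\dots,v_m$ are all of class $C^r$ in the ordinary sense on the manifold $G$, these $v_{m+1},\dots,v_{m+m'}$ are of class $C^r$ too. -/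

import Mathlib

open scoped ContDiff Manifold

/-- A Carnot group, written in exponential coordinates. `G` is a Lie group whose underlying manifold
is a finite-dimensional real vector space (so it is simply connected) and whose exponential map is
the identity: the straight lines `t ↦ t • x` through the origin are the one-parameter subgroups. In
particular the neutral element `1` is the zero vector. Its Lie algebra (Mathlib's
`GroupLieAlgebra`, the tangent space at `1` with the bracket of left-invariant vector fields) is
stratified as `V₁ ⊕ ⋯ ⊕ V_s`, where `V_{r+1} = [V₁, V_r]` for `1 ≤ r ≤ s` and `V_{s+1} = 0`.
Since the exponential map of a simply connected nilpotent Lie group is a diffeomorphism, every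
simply connected Lie group with a stratified Lie algebra has exactly one such description.
The norm of `G` as a vector space plays no role; only its topology does. -/
structure CarnotGroup (G : Type*) [NormedAddCommGroup G] [NormedSpace ℝ G]
    [FiniteDimensional ℝ G] [Group G] [LieGroup 𝓘(ℝ, G) ∞ G] where
  /-- the lines through the origin are one-parameter subgroups, i.e. `exp` is the identity -/
  smul_mul_smul : ∀ (s t : ℝ) (x : G), (s • x) * (t • x) = (s + t) • x
  /-- the number `s` of layers -/
  step : ℕ
  /-- the layers `V₁, …, V_s, V_{s+1}`; the other values are irrelevant -/
  layer : ℕ → Submodule ℝ (GroupLieAlgebra 𝓘(ℝ, G) G)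
  isInternal : DirectSum.IsInternal fun r : Fin step => layer (r + 1)
  layer_succ : ∀ r, 1 ≤ r → r ≤ step →
    layer (r + 1) = Submodule.span ℝ {z | ∃ x ∈ layer 1, ∃ y ∈ layer r, ⁅x, y⁆ = z}
  layer_step_succ : layer (step + 1) = ⊥

namespace CarnotGroup

section

variable {G : Type*} [NormedAddCommGroup G] [NormedSpace ℝ G] [FiniteDimensional ℝ G] [Group G]
  [LieGroup 𝓘(ℝ, G) ∞ G]

/-- The Hausdorff dimension `n_h = ∑ r, r * dim V_r`. -/
noncomputable def hausdorffDim (𝒢 : CarnotGroup G) : ℕ :=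
  ∑ r ∈ Finset.Icc 1 𝒢.step, r * Module.finrank ℝ (𝒢.layer r)

/-- The exponential map, which is the identity in exponential coordinates. -/
def exp (_𝒢 : CarnotGroup G) (x : GroupLieAlgebra 𝓘(ℝ, G) G) : G := x

variable {F : Type*} [NormedAddCommGroup F] [NormedSpace ℝ F] {d : ℕ}

/-- The left-invariant vector field `x` applied to `φ`:
`(x φ)(p) = d/dt φ(p * exp (t x))` at `t = 0`. -/
noncomputable def fieldDeriv (𝒢 : CarnotGroup G) (x : GroupLieAlgebra 𝓘(ℝ, G) G) (φ : G → F)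
    (p : G) : F :=
  deriv (fun t : ℝ => φ (p * 𝒢.exp (t • x))) 0

/-- `X_{i₁} X_{i₂} ⋯ X_{i_l} φ` for a word `i₁ i₂ ⋯ i_l`, where `X` is a basis of `V₁`. -/
noncomputable def wordDeriv (𝒢 : CarnotGroup G) (X : Module.Basis (Fin d) ℝ (𝒢.layer 1))
    (φ : G → F) : List (Fin d) → G → F
  | [] => φ
  | i :: w => 𝒢.fieldDeriv (X i) (𝒢.wordDeriv X φ w)

/-- `φ` is of class `C^j` on the Carnot group: all the iterated horizontal derivatives
`X_{i₁} ⋯ X_{i_l} φ` with `l ≤ j` exist everywhere and are continuous. -/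
def HorizontalContDiff (𝒢 : CarnotGroup G) (X : Module.Basis (Fin d) ℝ (𝒢.layer 1)) (j : ℕ)
    (φ : G → F) : Prop :=
  (∀ w : List (Fin d), w.length ≤ j → Continuous (𝒢.wordDeriv X φ w)) ∧
  ∀ w : List (Fin d), w.length < j → ∀ (i : Fin d) (p : G),
    DifferentiableAt ℝ (fun t : ℝ => 𝒢.wordDeriv X φ w (p * 𝒢.exp (t • (X i : _)))) 0

/-- The iterated horizontal gradient `∇^l φ`: the family of all `X_{i₁} ⋯ X_{i_l} φ`, with the
Euclidean norm on families. -/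
noncomputable def nabla (𝒢 : CarnotGroup G) (X : Module.Basis (Fin d) ℝ (𝒢.layer 1)) (l : ℕ)
    (φ : G → F) (p : G) : PiLp 2 (fun _ : Fin l → Fin d => F) :=
  WithLp.toLp 2 fun I => 𝒢.wordDeriv X φ (List.ofFn I) p

/-- The supremum norm `‖f‖_{C⁰}`, with the value `∞` for unbounded `f`. -/
noncomputable def supNorm {E : Type*} [NormedAddCommGroup E] (f : G → E) : ENNReal :=
  ⨆ p, ‖f p‖ₑ

/-- The weighted seminorm `∑_{k=1}^j R_k ‖∇^k φ‖_{C⁰}`. -/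
noncomputable def weightedSeminorm (𝒢 : CarnotGroup G) (X : Module.Basis (Fin d) ℝ (𝒢.layer 1))
    (j : ℕ) (R : ℕ → ℝ) (φ : G → F) : ENNReal :=
  ∑ k ∈ Finset.Icc 1 j, ENNReal.ofReal (R k) * supNorm (𝒢.nabla X k φ)

end

end CarnotGroup

/-! The fields are added one at a time, so the core is to extend `M` orthonormal fields v_i by one
unit field with bounds independent of `D` (`exists_orthogonal_unit_field`). That field is the
normalization of w₀ = u − ∑ ⟨v_i, u⟩ v_i, where u is smooth, |u| ≥ 1, and each ⟨v_i, u⟩ is so small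
that |w₀|² = |u|² − ∑ ⟨v_i, u⟩² ≥ 1/2.

To find u, dilate so that the v_i vary by at most 4ε between points at Carnot-Carathéodory distance
at most 4. Take a maximal set of points g whose unit balls are disjoint, and choose greedily unit
vectors u_g, each orthogonal to all v_i(g) and to the u_g' of the other points g' at distance at
most 8. A volume count bounds the number of such g' by 2·10^n < 2^(4n+7)·n with n the Hausdorff
dimension, so the dimension hypothesis leaves room for the choice. Put U = ∑ φ_g u_g with bumps φ_g
equal to 1 at distance 2 and vanishing beyond distance 4 (`exists_field_almost_orthogonal`).
Overlapping bumps carry orthogonal vectors, hence |U|² = ∑ φ_g² ≥ 1, and u_g is orthogonal to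
v_i(g), which is close to v_i wherever φ_g ≠ 0. The number of overlapping bumps is bounded, so
neither the bounds on U nor those on ⟨v_i, U⟩ depend on `D`.

Derivatives of order l are measured against S_l = 1/R_l, with S_0 = 1. The hypothesis on R says S_i
S_i' ≤ S_(i+i'), which is what the Leibniz rule needs (`HBound.bilin`, `exists_hBound_inv_sqrt`); it
also gives S_1^l ≤ S_l, so dilating on the scale R_1 is compatible with all the weights.

The geometry comes from the stratification. Scaling the layers is a Lie algebra homomorphism, hence
multiplicative in exponential coordinates (`map_mul_of_map_lieBr`); its determinant is s^n
(`det_dil`), which drives the count in `card_le_of_pairwiseDisjoint`; and since the first layer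
generates, balls are neighborhoods of 1 (`ccBall_mem_nhds`). -/

open scoped Topology

set_option linter.unusedSectionVars false

/-! ### Translations, the left-invariant frame and the bracket in coordinates -/

section LieGroupOnVectorSpace

variable {G : Type*} [NormedAddCommGroup G] [NormedSpace ℝ G] [Group G]
  [LieGroup 𝓘(ℝ, G) ∞ G]

/-- Multiplication, as a function on the vector space `G × G`. -/
def mulFun (G : Type*) [Mul G] (z : G × G) : G := z.1 * z.2

theorem contDiff_mulFun : ContDiff ℝ ∞ (mulFun G) := by
  have h := contMDiff_mul 𝓘(ℝ, G) ∞ (G := G)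
  rw [← modelWithCornersSelf_prod] at h
  have h' : @ContMDiff ℝ _ (G × G) _ _ (G × G) _ 𝓘(ℝ, G × G) (G × G) _ (chartedSpaceSelf (G × G))
      G _ _ G _ 𝓘(ℝ, G) G _ _ ∞ (mulFun G) := by
    rw [← chartedSpaceSelf_prod]; exact h
  exact contMDiff_iff_contDiff.1 h'

theorem ContDiff.groupMul {H : Type*} [NormedAddCommGroup H] [NormedSpace ℝ H] {n : ℕ∞}
    {f g : H → G} (hf : ContDiff ℝ n f) (hg : ContDiff ℝ n g) :
    ContDiff ℝ n fun z => f z * g z :=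
  (contDiff_mulFun.of_le (by exact_mod_cast le_top)).comp (hf.prodMk hg)

theorem contDiff_groupInv : ContDiff ℝ ∞ (fun z : G => z⁻¹) :=
  contMDiff_iff_contDiff.1 (contMDiff_inv 𝓘(ℝ, G) ∞ (G := G))

/-- The differential at `b` of the left translation by `a`. -/
noncomputable def leftDiff (a b : G) : G →L[ℝ] G :=
  (fderiv ℝ (mulFun G) (a, b)).comp (ContinuousLinearMap.inr ℝ G G)

/-- The differential at `a` of the right translation by `b`. -/
noncomputable def rightDiff (a b : G) : G →L[ℝ] G :=
  (fderiv ℝ (mulFun G) (a, b)).comp (ContinuousLinearMap.inl ℝ G G)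

theorem hasFDerivAt_mulFun (z : G × G) : HasFDerivAt (mulFun G) (fderiv ℝ (mulFun G) z) z :=
  ((contDiff_mulFun.differentiable (by simp)) z).hasFDerivAt

theorem hasFDerivAt_mul_left (a b : G) : HasFDerivAt (fun y : G => a * y) (leftDiff a b) b := by
  have h := (hasFDerivAt_mulFun (a, b)).comp b
    ((hasFDerivAt_const a b).prodMk (hasFDerivAt_id b))
  exact h

theorem hasFDerivAt_mul_right (a b : G) : HasFDerivAt (fun y : G => y * b) (rightDiff a b) a := by
  have h := HasFDerivAt.comp (f := fun y => (y, b)) a (hasFDerivAt_mulFun (a, b))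
    ((hasFDerivAt_id a).prodMk (hasFDerivAt_const b a))
  exact h

theorem contDiff_fderiv_mulFun : ContDiff ℝ ∞ (fderiv ℝ (mulFun G)) :=
  contDiff_mulFun.fderiv_right (m := ∞) (by simp)

theorem contDiff_leftDiff : ContDiff ℝ ∞ (fun z : G × G => leftDiff z.1 z.2) :=
  contDiff_fderiv_mulFun.clm_comp contDiff_const

theorem leftDiff_mul (a b c : G) : leftDiff (a * b) c = (leftDiff a (b * c)).comp (leftDiff b c) := by
  have h := (hasFDerivAt_mul_left a (b * c)).comp c (hasFDerivAt_mul_left b c)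
  refine (hasFDerivAt_mul_left (a * b) c).unique ?_
  convert! h using 1
  ext y; simp [mul_assoc]

/-- Left and right translations commute by associativity; this is the chain rule applied to both
orders. -/
theorem rightDiff_leftDiff (a b c : G) :
    (rightDiff (a * b) c).comp (leftDiff a b) = (leftDiff a (b * c)).comp (rightDiff b c) := by
  have h := (hasFDerivAt_mul_right (a * b) c).comp b (hasFDerivAt_mul_left a b)
  have h' := (hasFDerivAt_mul_left a (b * c)).comp b (hasFDerivAt_mul_right b c)
  refine h.unique ?_
  convert! h' using 1
  ext y; simp [mul_assoc]

theorem leftDiff_one_left (b : G) : leftDiff 1 b = ContinuousLinearMap.id ℝ G := by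
  refine (hasFDerivAt_mul_left 1 b).unique ?_
  simpa using! hasFDerivAt_id b

theorem rightDiff_one_right (b : G) : rightDiff b 1 = ContinuousLinearMap.id ℝ G := by
  refine (hasFDerivAt_mul_right b 1).unique ?_
  simpa using! hasFDerivAt_id b

/-- The frame of left-invariant vector fields: `leftFrame p x` is the value at `p` of the
left-invariant vector field with the value `x` at the neutral element. -/
noncomputable def leftFrame (p : G) : G →L[ℝ] G := leftDiff p 1

/-- The inverse of `leftFrame p`. -/
noncomputable def leftCoframe (p : G) : G →L[ℝ] G := leftDiff p⁻¹ p

theorem contDiff_leftFrame : ContDiff ℝ ∞ (leftFrame : G → G →L[ℝ] G) :=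
  contDiff_leftDiff.comp (contDiff_id.prodMk contDiff_const)

theorem contDiff_leftCoframe : ContDiff ℝ ∞ (leftCoframe : G → G →L[ℝ] G) :=
  contDiff_leftDiff.comp (contDiff_groupInv.prodMk contDiff_id)

theorem leftCoframe_comp_leftFrame (p : G) :
    (leftCoframe p).comp (leftFrame p) = ContinuousLinearMap.id ℝ G := by
  have h := leftDiff_mul p⁻¹ p 1
  rw [inv_mul_cancel, leftDiff_one_left, mul_one] at h
  exact h.symm

theorem leftFrame_comp_leftCoframe (p : G) :
    (leftFrame p).comp (leftCoframe p) = ContinuousLinearMap.id ℝ G := by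
  have h := leftDiff_mul p p⁻¹ p
  rw [mul_inv_cancel, leftDiff_one_left, inv_mul_cancel] at h
  exact h.symm

theorem leftCoframe_leftFrame (p x : G) : leftCoframe p (leftFrame p x) = x :=
  DFunLike.congr_fun (leftCoframe_comp_leftFrame p) x

theorem leftFrame_leftCoframe (p x : G) : leftFrame p (leftCoframe p x) = x :=
  DFunLike.congr_fun (leftFrame_comp_leftCoframe p) x

theorem leftFrame_one : leftFrame (1 : G) = ContinuousLinearMap.id ℝ G := leftDiff_one_left 1

theorem leftCoframe_one : leftCoframe (1 : G) = ContinuousLinearMap.id ℝ G := by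
  rw [leftCoframe, inv_one, leftDiff_one_left]

theorem leftFrame_mul (a b : G) : leftFrame (a * b) = (leftDiff a b).comp (leftFrame b) := by
  rw [leftFrame, leftDiff_mul, mul_one, leftFrame]

theorem mulInvariantVectorField_eq (x : GroupLieAlgebra 𝓘(ℝ, G) G) (p : G) :
    mulInvariantVectorField x p = leftFrame p x := by
  rw [mulInvariantVectorField, mfderiv_eq_fderiv]
  exact DFunLike.congr_fun (hasFDerivAt_mul_left p 1).fderiv x

theorem hasFDerivAt_leftFrame (p : G) : HasFDerivAt leftFrame (fderiv ℝ leftFrame p) p :=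
  (contDiff_leftFrame.differentiable (by simp) p).hasFDerivAt

theorem hasFDerivAt_leftFrame_apply (p x : G) :
    HasFDerivAt (fun q => leftFrame q x) ((fderiv ℝ leftFrame p).flip x) p := by
  have h := (hasFDerivAt_leftFrame p).clm_apply (hasFDerivAt_const x p)
  convert! h using 1
  ext y; simp

/-- The Lie bracket of the Lie algebra of `G`, as a bilinear map on the vector space `G`. -/
noncomputable def lieBr (x y : G) : G :=
  fderiv ℝ leftFrame (1 : G) x y - fderiv ℝ leftFrame (1 : G) y x

theorem mlieBracket_mulInvariantVectorField (x y p : G) :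
    VectorField.mlieBracket 𝓘(ℝ, G) (mulInvariantVectorField (I := 𝓘(ℝ, G)) (G := G) x)
      (mulInvariantVectorField (I := 𝓘(ℝ, G)) (G := G) y) p =
      fderiv ℝ leftFrame p (leftFrame p x) y - fderiv ℝ leftFrame p (leftFrame p y) x := by
  have h : ∀ z : GroupLieAlgebra 𝓘(ℝ, G) G, mulInvariantVectorField z =
      fun q : G => (leftFrame q z : G) := fun z => funext fun q => mulInvariantVectorField_eq z q
  rw [← VectorField.mlieBracketWithin_univ, VectorField.mlieBracketWithin_eq_lieBracketWithin]
  erw [VectorField.lieBracketWithin_univ, h, h]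
  unfold VectorField.lieBracket
  erw [(hasFDerivAt_leftFrame_apply p x).fderiv, (hasFDerivAt_leftFrame_apply p y).fderiv]
  rfl

theorem groupLieAlgebra_bracket_eq (x y : G) :
    @Bracket.bracket (GroupLieAlgebra 𝓘(ℝ, G) G) (GroupLieAlgebra 𝓘(ℝ, G) G) _ x y =
      lieBr x y := by
  refine (mlieBracket_mulInvariantVectorField x y 1).trans ?_
  rw [leftFrame_one]
  rfl

instance lieGroup_minSmoothness : LieGroup 𝓘(ℝ, G) (minSmoothness ℝ 3) G := by
  have h : minSmoothness ℝ 3 ≤ ∞ := by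
    rw [minSmoothness_of_isRCLikeNormedField]
    exact WithTop.coe_le_coe.2 le_top
  exact LieGroup.of_le h

variable [CompleteSpace G]

/-- The bracket of two left-invariant fields is again left-invariant, so its coordinate expression
at any `p` is determined by its value at 1. -/
theorem leftFrame_lieBr (x y p : G) :
    leftFrame p (lieBr x y) =
      fderiv ℝ leftFrame p (leftFrame p x) y - fderiv ℝ leftFrame p (leftFrame p y) x := by
  have h := congrFun (mulInvariantVector_mlieBracket (I := 𝓘(ℝ, G)) (G := G) x y) p
  rw [mulInvariantVectorField_eq] at h
  exact (congrArg (leftFrame p) (groupLieAlgebra_bracket_eq x y)).symm.trans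
    (h.trans (mlieBracket_mulInvariantVectorField x y p))

theorem lieBr_jacobi (x y z : G) :
    lieBr (lieBr x y) z = lieBr x (lieBr y z) - lieBr y (lieBr x z) := by
  have h := lie_lie (L := GroupLieAlgebra 𝓘(ℝ, G) G) (M := GroupLieAlgebra 𝓘(ℝ, G) G) x y z
  simp only [groupLieAlgebra_bracket_eq] at h
  exact h

end LieGroupOnVectorSpace

/-! ### Bracket-preserving linear maps are multiplicative in exponential coordinates -/

section ExponentialCoordinates

variable {G : Type*} [NormedAddCommGroup G] [NormedSpace ℝ G] [Group G]
  [LieGroup 𝓘(ℝ, G) ∞ G]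

theorem one_eq_zero_of_smul_mul_smul (hexp : ∀ (s t : ℝ) (x : G), (s • x) * (t • x) = (s + t) • x) :
    (1 : G) = 0 := by
  have h := hexp 0 0 (1 : G)
  simp only [zero_smul, add_zero] at h
  exact (mul_eq_left.1 h).symm

theorem hasDerivAt_mul_smul (p x : G) (t : ℝ) :
    HasDerivAt (fun s : ℝ => p * (s • x)) (leftDiff p (t • x) x) t := by
  have h1 : HasDerivAt (fun s : ℝ => s • x) x t := by
    simpa using (hasDerivAt_id t).smul_const x
  exact (hasFDerivAt_mul_left p (t • x)).comp_hasDerivAt t h1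

theorem leftFrame_smul_self (hexp : ∀ (s t : ℝ) (x : G), (s • x) * (t • x) = (s + t) • x)
    (t : ℝ) (x : G) : leftFrame (t • x) x = x := by
  have h := hasDerivAt_mul_smul (t • x) x 0
  have h1 : HasDerivAt (fun s : ℝ => (t + s) • x) x 0 := by
    simpa using ((hasDerivAt_id (0 : ℝ)).const_add t).smul_const x
  rw [zero_smul, ← one_eq_zero_of_smul_mul_smul hexp] at h
  simp only [hexp] at h
  exact h.unique h1

theorem rightDiff_one_smul_self (hexp : ∀ (s t : ℝ) (x : G), (s • x) * (t • x) = (s + t) • x)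
    (t : ℝ) (x : G) : rightDiff 1 (t • x) x = x := by
  have h0 : HasDerivAt (fun s : ℝ => s • x) x 0 := by
    simpa using (hasDerivAt_id (0 : ℝ)).smul_const x
  have hr : HasFDerivAt (fun y : G => y * t • x) (rightDiff 1 (t • x)) ((0 : ℝ) • x) := by
    rw [zero_smul, ← one_eq_zero_of_smul_mul_smul hexp]
    exact hasFDerivAt_mul_right 1 (t • x)
  have h := hr.comp_hasDerivAt 0 h0
  have h1 : HasDerivAt (fun s : ℝ => (s + t) • x) x 0 := by
    simpa using ((hasDerivAt_id (0 : ℝ)).add_const t).smul_const x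
  simp only [Function.comp_def, hexp] at h
  exact h.unique h1

theorem leftDiff_smul_self (hexp : ∀ (s t : ℝ) (x : G), (s • x) * (t • x) = (s + t) • x)
    (p : G) (t : ℝ) (x : G) : leftDiff p (t • x) x = leftFrame (p * t • x) x := by
  rw [leftFrame_mul, ContinuousLinearMap.comp_apply, leftFrame_smul_self hexp]

theorem hasDerivAt_mul_smul' (hexp : ∀ (s t : ℝ) (x : G), (s • x) * (t • x) = (s + t) • x)
    (p : G) (t : ℝ) (x : G) :
    HasDerivAt (fun s : ℝ => p * (s • x)) (leftFrame (p * t • x) x) t := by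
  rw [← leftDiff_smul_self hexp]
  exact hasDerivAt_mul_smul p x t

theorem leftFrame_self (hexp : ∀ (s t : ℝ) (x : G), (s • x) * (t • x) = (s + t) • x)
    (p : G) : leftFrame p p = p := by
  simpa using leftFrame_smul_self hexp 1 p

/-- Product rule applied to the identity `leftFrame p p = p`, which holds because rays are
one-parameter subgroups. -/
theorem fderiv_leftFrame_self (hexp : ∀ (s t : ℝ) (x : G), (s • x) * (t • x) = (s + t) • x)
    (p w : G) : fderiv ℝ leftFrame p w p + leftFrame p w = w := by
  have h := (hasFDerivAt_leftFrame p).clm_apply (hasFDerivAt_id p)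
  have h1 : (fun y : G => leftFrame y (id y)) = id := by
    ext y; exact leftFrame_self hexp y
  rw [h1] at h
  have h2 := DFunLike.congr_fun (h.unique (hasFDerivAt_id p)) w
  simpa [add_comm] using h2

theorem hasFDerivAt_leftCoframe (p : G) :
    HasFDerivAt leftCoframe (fderiv ℝ leftCoframe p) p :=
  (contDiff_leftCoframe.differentiable (by simp) p).hasFDerivAt

theorem leftFrame_fderiv_leftCoframe (p u w : G) :
    fderiv ℝ leftFrame p u (leftCoframe p w) + leftFrame p (fderiv ℝ leftCoframe p u w) = 0 := by
  have h := (hasFDerivAt_leftFrame p).clm_comp (hasFDerivAt_leftCoframe p)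
  simp only [leftFrame_comp_leftCoframe] at h
  have h2 := DFunLike.congr_fun (DFunLike.congr_fun (h.unique (hasFDerivAt_const _ p)) u) w
  simpa [add_comm] using h2

/-- The adjoint representation of the Lie algebra of `G`. -/
noncomputable def lieAd (x : G) : G →L[ℝ] G :=
  fderiv ℝ leftFrame (1 : G) x - (fderiv ℝ leftFrame (1 : G)).flip x

theorem lieAd_apply (x y : G) : lieAd x y = lieBr x y := by
  simp [lieAd, lieBr]

variable [CompleteSpace G]

/-- The ODE behind the formula (1 − e^(−ad x)) / ad x for the left-trivialized differential of the
exponential map: Y(t) = t · `leftCoframe (t • x)` solves Y' = 1 − ad x ∘ Y with Y(0) = 0. Thus the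
coframe, and with it the group law, is determined by the bracket alone. -/
theorem hasDerivAt_smul_leftCoframe
    (hexp : ∀ (s t : ℝ) (x : G), (s • x) * (t • x) = (s + t) • x) (x : G) (t : ℝ) :
    HasDerivAt (fun s : ℝ => s • leftCoframe (s • x))
      (ContinuousLinearMap.id ℝ G - (lieAd x).comp (t • leftCoframe (t • x))) t := by
  have h1 : HasDerivAt (fun s : ℝ => s • x) x t := by
    simpa using (hasDerivAt_id t).smul_const x
  have h2 := (hasDerivAt_id t).smul ((hasFDerivAt_leftCoframe (t • x)).comp_hasDerivAt t h1)
  convert! h2 using 1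
  ext w
  -- The frame is injective, and after applying it only derivatives of the frame remain: `e1`
  -- removes the derivative of the coframe, `e2` the bracket, and `e3` with `e4` the remaining
  -- derivative in the direction `w`.
  apply_fun leftFrame (t • x) using fun a b hab => by
    simpa only [leftCoframe_leftFrame] using congrArg (leftCoframe (t • x)) hab
  set p := t • x with hp
  have e1 := leftFrame_fderiv_leftCoframe p x w
  have e2 := leftFrame_lieBr x (leftCoframe p w) p
  have e3 := fderiv_leftFrame_self hexp p w
  rw [leftFrame_leftCoframe, hp, leftFrame_smul_self hexp, ← hp] at e2
  have e4 : fderiv ℝ leftFrame p w p = t • fderiv ℝ leftFrame p w x := by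
    conv_lhs => rw [hp]
    rw [map_smul, hp]
  rw [e4] at e3
  simp only [sub_apply, ContinuousLinearMap.id_apply,
    ContinuousLinearMap.comp_apply, smul_apply, map_sub, map_smul,
    lieAd_apply, e2, id, add_apply, map_add, leftFrame_leftCoframe,
    Function.comp, ← hp]
  rw [eq_neg_of_add_eq_zero_right e1]
  conv_lhs => rw [eq_sub_of_add_eq' e3]
  module

/-- Since `A` intertwines ad x with ad (A x), both sides multiplied by t, at t • x and t • A x,
solve the linear ODE Y' = A − ad (A x) ∘ Y with Y(0) = 0. Uniqueness gives equality at t = 1. -/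
theorem leftCoframe_equivariant
    (hexp : ∀ (s t : ℝ) (x : G), (s • x) * (t • x) = (s + t) • x)
    (A : G →L[ℝ] G) (hA : ∀ x y, A (lieBr x y) = lieBr (A x) (A y)) (x y : G) :
    A (leftCoframe x y) = leftCoframe (A x) (A y) := by
  let f : ℝ → G →L[ℝ] G := fun t => A.comp (t • leftCoframe (t • x))
  let g : ℝ → G →L[ℝ] G := fun t => (t • leftCoframe (t • A x)).comp A
  let V : ℝ → (G →L[ℝ] G) → (G →L[ℝ] G) := fun _ Y => A - (lieAd (A x)).comp Y
  have hf : ∀ t, HasDerivAt f (V t (f t)) t := by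
    intro t
    have h := (hasDerivAt_const t A).clm_comp (hasDerivAt_smul_leftCoframe hexp x t)
    convert! h using 1
    ext w
    simp [V, f, lieAd_apply, hA]
  have hg : ∀ t, HasDerivAt g (V t (g t)) t := by
    intro t
    have h := (hasDerivAt_smul_leftCoframe hexp (A x) t).clm_comp (hasDerivAt_const t A)
    convert! h using 1
    ext w
    simp [V, g]
  have hV : ∀ t, LipschitzOnWith ‖lieAd (A x)‖₊ (V t) Set.univ := by
    intro t
    refine LipschitzOnWith.of_dist_le_mul fun Y _ Z _ => ?_
    simp only [V, dist_eq_norm]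
    rw [sub_sub_sub_cancel_left, ← ContinuousLinearMap.comp_sub, norm_sub_rev]
    exact ContinuousLinearMap.opNorm_comp_le _ _
  have h := ODE_solution_unique_univ (s := fun _ => Set.univ) (t₀ := 0) hV
    (fun t => ⟨hf t, trivial⟩) (fun t => ⟨hg t, trivial⟩) (by simp [f, g])
  have h1 := DFunLike.congr_fun (congrFun h 1) y
  simpa [f, g] using h1

/-- `A` carries left-invariant fields to left-invariant fields, so t ↦ A(p · tx) and t ↦ A(p) ·
tA(x) are integral curves of the same field. Concretely, A(p · tx) · (−tA(x)) has zero derivative;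
it is compared at t = 1 and t = 0. -/
theorem map_mul_of_map_lieBr
    (hexp : ∀ (s t : ℝ) (x : G), (s • x) * (t • x) = (s + t) • x)
    (A : G →L[ℝ] G) (hA : ∀ x y, A (lieBr x y) = lieBr (A x) (A y)) (p x : G) :
    A (p * x) = A p * A x := by
  have hE : ∀ p y, A (leftFrame p y) = leftFrame (A p) (A y) := by
    intro p y
    have h := leftCoframe_equivariant hexp A hA p (leftFrame p y)
    rw [leftCoframe_leftFrame] at h
    rw [h, leftFrame_leftCoframe]
  have hinv : ∀ t : ℝ, ∀ y : G, (t • y) * (-t • y) = 1 := fun t y => by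
    rw [hexp, add_neg_cancel, zero_smul, one_eq_zero_of_smul_mul_smul hexp]
  have key : ∀ t : ℝ, HasDerivAt (fun t : ℝ => A (p * t • x) * (-t • A x)) 0 t := by
    intro t
    have h1 := A.hasFDerivAt.comp_hasDerivAt t (hasDerivAt_mul_smul' hexp p t x)
    have h2 : HasDerivAt (fun s : ℝ => -s • A x) (-A x) t := by
      simpa using ((hasDerivAt_id t).neg).smul_const (A x)
    have h3 := (hasFDerivAt_mulFun (A (p * t • x), -t • A x)).comp_hasDerivAt t (h1.prodMk h2)
    convert! h3 using 1
    set a := A (p * t • x)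
    have h4 := DFunLike.congr_fun (rightDiff_leftDiff a 1 (-t • A x)) (A x)
    simp only [ContinuousLinearMap.comp_apply, mul_one, one_mul,
      rightDiff_one_smul_self hexp] at h4
    have e : ((A (leftFrame (p * t • x) x), -A x) : G × G) =
        ContinuousLinearMap.inl ℝ G G (leftFrame a (A x)) -
          ContinuousLinearMap.inr ℝ G G (A x) := by
      rw [hE]; simp [a]
    rw [e, map_sub, eq_comm, sub_eq_zero]
    exact h4
  have hc := is_const_of_deriv_eq_zero (fun t => (key t).differentiableAt)
    (fun t => (key t).deriv) 1 0
  simp only [one_smul, neg_zero, zero_smul, ← one_eq_zero_of_smul_mul_smul hexp, mul_one] at hc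
  rw [← hc, mul_assoc]
  have := hinv (-1) (A x)
  simp only [neg_neg, one_smul] at this
  rw [this, mul_one]

end ExponentialCoordinates

namespace CarnotGroup

/-! ### Dilations: automorphisms with determinant s ^ n_h -/

section Dilations

variable {G : Type*} [NormedAddCommGroup G] [NormedSpace ℝ G] [FiniteDimensional ℝ G] [Group G]
  [LieGroup 𝓘(ℝ, G) ∞ G] (𝒢 : CarnotGroup G)

/-- The `r`-th layer, as a subspace of the vector space `G`. -/
def stratum (r : ℕ) : Submodule ℝ G := 𝒢.layer r

theorem isInternal_stratum : DirectSum.IsInternal fun r : Fin 𝒢.step => 𝒢.stratum (r + 1) :=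
  𝒢.isInternal

theorem stratum_succ (r : ℕ) (h1 : 1 ≤ r) (h2 : r ≤ 𝒢.step) :
    𝒢.stratum (r + 1) = Submodule.span ℝ {z | ∃ x ∈ 𝒢.stratum 1, ∃ y ∈ 𝒢.stratum r, lieBr x y = z} := by
  refine (𝒢.layer_succ r h1 h2).trans (congrArg (Submodule.span ℝ) (Set.ext fun z =>
    ⟨fun ⟨x, hx, y, hy, h⟩ =>
      ⟨x, hx, y, hy, (groupLieAlgebra_bracket_eq (G := G) x y).symm.trans h⟩,
    fun ⟨x, hx, y, hy, h⟩ =>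
      ⟨x, hx, y, hy, (groupLieAlgebra_bracket_eq (G := G) x y).trans h⟩⟩))

theorem stratum_step_succ : 𝒢.stratum (𝒢.step + 1) = ⊥ := 𝒢.layer_step_succ

theorem lieBr_mem_stratum {r : ℕ} (h1 : 1 ≤ r) (h2 : r ≤ 𝒢.step) {x y : G}
    (hx : x ∈ 𝒢.stratum 1) (hy : y ∈ 𝒢.stratum r) : lieBr x y ∈ 𝒢.stratum (r + 1) := by
  rw [𝒢.stratum_succ r h1 h2]
  exact Submodule.subset_span ⟨x, hx, y, hy, rfl⟩

theorem iSup_stratum : (⨆ r : Fin 𝒢.step, 𝒢.stratum (r + 1)) = ⊤ :=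
  𝒢.isInternal_stratum.submodule_iSup_eq_top

/-- A basis of `G` adapted to the stratification. -/
noncomputable def stratBasis :
    Module.Basis (Σ r : Fin 𝒢.step, Fin (Module.finrank ℝ (𝒢.stratum (r + 1)))) ℝ G :=
  𝒢.isInternal_stratum.collectedBasis fun _ => Module.finBasis ℝ _

/-- The dilation of `G` with the factor `s`: multiplication by `s ^ r` on the `r`-th layer. -/
noncomputable def dil (s : ℝ) : G →L[ℝ] G :=
  ∑ k, s ^ (k.1 + 1 : ℕ) •
    (LinearMap.toContinuousLinearMap (𝒢.stratBasis.coord k)).smulRight (𝒢.stratBasis k)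

theorem dil_apply (s : ℝ) (x : G) :
    𝒢.dil s x = ∑ k, s ^ (k.1 + 1 : ℕ) • 𝒢.stratBasis.repr x k • 𝒢.stratBasis k := by
  simp [dil]

theorem dil_stratBasis (s : ℝ) (k) :
    𝒢.dil s (𝒢.stratBasis k) = s ^ (k.1 + 1 : ℕ) • 𝒢.stratBasis k := by
  rw [dil_apply, Finset.sum_eq_single k]
  · simp
  · intro l _ hl
    simp [Finsupp.single_eq_of_ne hl]
  · simp

theorem dil_of_mem {s : ℝ} {r : ℕ} (h1 : 1 ≤ r) (h2 : r ≤ 𝒢.step + 1) {x : G}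
    (hx : x ∈ 𝒢.stratum r) : 𝒢.dil s x = s ^ r • x := by
  rcases h2.lt_or_eq with h2 | rfl
  · obtain ⟨r, rfl⟩ : ∃ q, r = q + 1 := ⟨r - 1, by omega⟩
    let i : Fin 𝒢.step := ⟨r, by omega⟩
    have hx' : x ∈ 𝒢.stratum (i + 1) := hx
    rw [dil_apply]
    conv_rhs => rw [← 𝒢.stratBasis.sum_repr x, Finset.smul_sum]
    refine Finset.sum_congr rfl fun k _ => ?_
    by_cases hk : k.1 = i
    · rw [hk]
    · have : 𝒢.stratBasis.repr x k = 0 :=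
        𝒢.isInternal_stratum.collectedBasis_repr_of_mem_ne _ (Ne.symm hk) hx'
      simp [this]
  -- The index one past the last layer is allowed because brackets of the first layer with the last
  -- one land there; that layer is zero.
  · rw [𝒢.stratum_step_succ, Submodule.mem_bot] at hx
    simp [hx]

theorem strata_induction {P : G → Prop} (h0 : P 0) (hadd : ∀ x y, P x → P y → P (x + y))
    (hP : ∀ r, 1 ≤ r → r ≤ 𝒢.step → ∀ x ∈ 𝒢.stratum r, P x) (x : G) : P x := by
  have hx : x ∈ ⨆ r : Fin 𝒢.step, 𝒢.stratum (r + 1) := by rw [iSup_stratum]; trivial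
  exact Submodule.iSup_induction _ (motive := P) hx (fun r y hy => hP _ (by omega) (by omega) y hy) h0 hadd

theorem lieBr_add_left (x y z : G) : lieBr (x + y) z = lieBr x z + lieBr y z := by
  simp [lieBr]; abel

theorem lieBr_smul_left (c : ℝ) (x z : G) : lieBr (c • x) z = c • lieBr x z := by
  simp [lieBr, smul_sub]

theorem lieBr_zero_left (z : G) : lieBr 0 z = 0 := by
  simp [lieBr]

theorem lieBr_add_right (x y z : G) : lieBr x (y + z) = lieBr x y + lieBr x z := by
  simp [← lieAd_apply]

theorem lieBr_smul_right (c : ℝ) (x z : G) : lieBr x (c • z) = c • lieBr x z := by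
  simp [← lieAd_apply]

theorem lieBr_zero_right (x : G) : lieBr x 0 = 0 := by
  simp [← lieAd_apply]

/-- For `x` in the first layer this is the grading [V₁, V_r] ⊆ V_(r+1). Higher layers are spanned by
brackets [a, b] with a in the first layer, and the Jacobi identity [[a, b], y] = [a, [b, y]] − [b,
[a, y]] reduces them to lower ones. -/
theorem dil_lieBr (s : ℝ) (x y : G) : 𝒢.dil s (lieBr x y) = lieBr (𝒢.dil s x) (𝒢.dil s y) := by
  have h1 : ∀ x ∈ 𝒢.stratum 1, ∀ y, 𝒢.dil s (lieBr x y) = lieBr (𝒢.dil s x) (𝒢.dil s y) := by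
    intro x hx y
    refine 𝒢.strata_induction (P := fun y => 𝒢.dil s (lieBr x y) =
      lieBr (𝒢.dil s x) (𝒢.dil s y)) ?_ ?_ ?_ y
    · simp [lieBr_zero_right]
    · intro y z hy hz
      simp only [map_add, lieBr_add_right, hy, hz]
    · intro r hr1 hr2 y hy
      rw [𝒢.dil_of_mem (by omega) (by omega) (𝒢.lieBr_mem_stratum hr1 hr2 hx hy),
        𝒢.dil_of_mem le_rfl (by omega) hx, 𝒢.dil_of_mem hr1 (by omega) hy,
        lieBr_smul_left, lieBr_smul_right, smul_smul]
      congr 1; ring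
  have h2 : ∀ r, 1 ≤ r → r ≤ 𝒢.step → ∀ x ∈ 𝒢.stratum r, ∀ y,
      𝒢.dil s (lieBr x y) = lieBr (𝒢.dil s x) (𝒢.dil s y) := by
    intro r hr
    induction r, hr using Nat.le_induction with
    | base => intro _; exact h1
    | succ r hr ih =>
      intro hr2 x hx
      rw [𝒢.stratum_succ r hr (by omega)] at hx
      induction hx using Submodule.span_induction with
      | mem x hx =>
        obtain ⟨a, ha, b, hb, rfl⟩ := hx
        intro y
        have ihb := ih (by omega) b hb
        rw [lieBr_jacobi, map_sub, h1 a ha, ihb, ihb, h1 a ha, h1 a ha, lieBr_jacobi]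
      | zero => intro y; simp [lieBr_zero_left]
      | add x z _ _ hx hz => intro y; simp only [map_add, lieBr_add_left, hx, hz]
      | smul c x _ hx => intro y; simp only [map_smul, lieBr_smul_left, hx]
  refine 𝒢.strata_induction (P := fun x => 𝒢.dil s (lieBr x y) =
    lieBr (𝒢.dil s x) (𝒢.dil s y)) ?_ ?_ ?_ x
  · simp [lieBr_zero_left]
  · intro x z hx hz
    simp only [map_add, lieBr_add_left, hx, hz]
  · intro r hr1 hr2 x hx
    exact h2 r hr1 hr2 x hx y

theorem dil_mul (𝒢 : CarnotGroup G) (s : ℝ) (x y : G) : 𝒢.dil s (x * y) = 𝒢.dil s x * 𝒢.dil s y :=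
  map_mul_of_map_lieBr 𝒢.smul_mul_smul _ (𝒢.dil_lieBr s) x y

theorem one_eq_zero (𝒢 : CarnotGroup G) : (1 : G) = 0 := one_eq_zero_of_smul_mul_smul 𝒢.smul_mul_smul

theorem inv_eq_neg (𝒢 : CarnotGroup G) (x : G) : x⁻¹ = -x := by
  rw [inv_eq_iff_mul_eq_one]
  have h := 𝒢.smul_mul_smul 1 (-1) x
  simpa [𝒢.one_eq_zero] using h

theorem dil_one_right (s : ℝ) : 𝒢.dil s 1 = 1 := by
  rw [𝒢.one_eq_zero, map_zero]

theorem dil_inv (s : ℝ) (x : G) : 𝒢.dil s x⁻¹ = (𝒢.dil s x)⁻¹ := by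
  rw [𝒢.inv_eq_neg, 𝒢.inv_eq_neg, map_neg]

theorem dil_dil (s t : ℝ) (x : G) : 𝒢.dil s (𝒢.dil t x) = 𝒢.dil (s * t) x := by
  have h : (𝒢.dil s).toLinearMap ∘ₗ (𝒢.dil t).toLinearMap = (𝒢.dil (s * t)).toLinearMap :=
    𝒢.stratBasis.ext fun k => by
      simp only [LinearMap.comp_apply, ContinuousLinearMap.coe_coe, dil_stratBasis, map_smul,
        smul_smul]
      congr 1; ring
  exact DFunLike.congr_fun h x

theorem dil_one (x : G) : 𝒢.dil 1 x = x := by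
  have h : (𝒢.dil 1).toLinearMap = LinearMap.id :=
    𝒢.stratBasis.ext fun k => by simp [dil_stratBasis]
  exact DFunLike.congr_fun h x

theorem dil_inv_dil {s : ℝ} (hs : s ≠ 0) (x : G) : 𝒢.dil s⁻¹ (𝒢.dil s x) = x := by
  rw [dil_dil, inv_mul_cancel₀ hs, dil_one]

theorem dil_dil_inv {s : ℝ} (hs : s ≠ 0) (x : G) : 𝒢.dil s (𝒢.dil s⁻¹ x) = x := by
  rw [dil_dil, mul_inv_cancel₀ hs, dil_one]

theorem dil_zero : 𝒢.dil 0 = 0 := by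
  simp [dil]

theorem continuous_dil : Continuous 𝒢.dil := by
  unfold dil
  fun_prop

theorem sum_finrank_stratum :
    ∑ r ∈ Finset.Icc 1 𝒢.step, r * Module.finrank ℝ (𝒢.stratum r) =
      ∑ r : Fin 𝒢.step, ((r : ℕ) + 1) * Module.finrank ℝ (𝒢.stratum (r + 1)) := by
  rw [Fin.sum_univ_eq_sum_range (fun r => (r + 1) * Module.finrank ℝ (𝒢.stratum (r + 1))),
    Finset.range_eq_Ico, Finset.sum_Ico_add' (fun r => r * Module.finrank ℝ (𝒢.stratum r))]
  rfl

theorem det_dil (s : ℝ) : (𝒢.dil s).det = s ^ 𝒢.hausdorffDim := by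
  have h : LinearMap.toMatrix 𝒢.stratBasis 𝒢.stratBasis (𝒢.dil s).toLinearMap =
      Matrix.diagonal fun k => s ^ (k.1 + 1 : ℕ) := by
    ext i k
    rw [LinearMap.toMatrix_apply]
    simp only [ContinuousLinearMap.coe_coe, dil_stratBasis, map_smul, Module.Basis.repr_self]
    rw [Matrix.diagonal_apply]
    by_cases hik : i = k
    · subst hik; simp
    · simp [hik, Finsupp.single_eq_of_ne hik]
  rw [ContinuousLinearMap.det, ← LinearMap.det_toMatrix 𝒢.stratBasis, h, Matrix.det_diagonal]
  rw [Fintype.prod_sigma]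
  simp only [Finset.prod_const, Finset.card_univ, Fintype.card_fin, ← pow_mul]
  rw [Finset.prod_pow_eq_pow_sum]
  congr 1
  exact (𝒢.sum_finrank_stratum).symm

/-- If the dimension were 0, the determinant of the dilation with factor 0 would be 0 ^ 0 = 1, but
that dilation is the zero map of a nontrivial space. -/
theorem one_le_hausdorffDim [Nontrivial G] : 1 ≤ 𝒢.hausdorffDim := by
  by_contra h
  have h0 : 𝒢.hausdorffDim = 0 := by omega
  have h1 := 𝒢.det_dil 0
  have h2 : (0 : G →L[ℝ] G).det = 0 := by
    rw [ContinuousLinearMap.det]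
    exact LinearMap.det_zero.trans (zero_pow Module.finrank_pos.ne')
  rw [h0, dil_zero, h2] at h1
  simp at h1

end Dilations

end CarnotGroup

/-! ### Carnot-Carathéodory balls as sets of words -/

section CCBall

/-- The ball of radius `r` for the Carnot-Carathéodory distance given by the directions `e i`:
the products of elements `tᵢ • e i` with `∑ |tᵢ| ≤ r`. -/
def ccBall {G ι : Type*} [AddCommGroup G] [Module ℝ G] [Group G] (e : ι → G) (r : ℝ) : Set G :=
  {g | ∃ l : List (ι × ℝ), (l.map fun a => |a.2|).sum ≤ r ∧ (l.map fun a => a.2 • e a.1).prod = g}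

variable {G ι : Type*} [AddCommGroup G] [Module ℝ G] [Group G] {e : ι → G} {r s : ℝ}

theorem one_mem_ccBall (hr : 0 ≤ r) : (1 : G) ∈ ccBall e r := ⟨[], by simpa, by simp⟩

theorem ccBall_mono (h : r ≤ s) : ccBall e r ⊆ ccBall e s := by
  rintro g ⟨l, h1, h2⟩
  exact ⟨l, h1.trans h, h2⟩

theorem mul_mem_ccBall {g h : G} (hg : g ∈ ccBall e r) (hh : h ∈ ccBall e s) :
    g * h ∈ ccBall e (r + s) := by
  obtain ⟨l, h1, rfl⟩ := hg
  obtain ⟨k, h2, rfl⟩ := hh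
  exact ⟨l ++ k, by simpa using add_le_add h1 h2, by simp⟩

theorem smul_mem_ccBall (i : ι) (t : ℝ) : t • e i ∈ ccBall e |t| :=
  ⟨[(i, t)], by simp, by simp⟩

end CCBall

/-! ### The adjoint representation and a Chow-type argument -/

section Chow

variable {G : Type*} [NormedAddCommGroup G] [NormedSpace ℝ G] [Group G]
  [LieGroup 𝓘(ℝ, G) ∞ G]

/-- The adjoint representation of `G`. -/
noncomputable def groupAd (h : G) : G →L[ℝ] G := (rightDiff h h⁻¹).comp (leftFrame h)

theorem hasFDerivAt_conj (h : G) : HasFDerivAt (fun y : G => h * y * h⁻¹) (groupAd h) 1 := by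
  have h1 : HasFDerivAt (fun y : G => y * h⁻¹) (rightDiff h h⁻¹) (h * 1) := by
    rw [mul_one]; exact hasFDerivAt_mul_right h h⁻¹
  exact h1.comp 1 (hasFDerivAt_mul_left h 1)

theorem groupAd_one : groupAd (1 : G) = ContinuousLinearMap.id ℝ G := by
  refine (hasFDerivAt_conj 1).unique ?_
  simpa using! hasFDerivAt_id (1 : G)

theorem groupAd_mul (g h : G) : groupAd (g * h) = (groupAd g).comp (groupAd h) := by
  refine (hasFDerivAt_conj (g * h)).unique ?_
  have h1 : HasFDerivAt (fun y : G => g * y * g⁻¹) (groupAd g) (h * 1 * h⁻¹) := by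
    simpa using hasFDerivAt_conj g
  have h2 := h1.comp 1 (hasFDerivAt_conj h)
  convert! h2 using 1
  ext y; simp [mul_assoc]

/-- In this form the base points of both factors depend on h⁻¹ only, which makes differentiation at
h = 1 easy. -/
theorem groupAd_eq (h : G) : groupAd h = (leftCoframe h⁻¹).comp (rightDiff 1 h⁻¹) := by
  have := rightDiff_leftDiff h 1 h⁻¹
  rw [mul_one, one_mul] at this
  rw [groupAd, leftFrame, this, leftCoframe, inv_inv]

theorem fderiv_leftFrame_one_eq (x w : G) :
    fderiv ℝ leftFrame (1 : G) x w = fderiv ℝ (fderiv ℝ (mulFun G)) (1, 1) (x, 0) (0, w) := by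
  have h := (contDiff_fderiv_mulFun (G := G)).differentiable (by simp) (1, 1)
  have h1 : HasFDerivAt (fun p : G => (p, (1 : G))) (ContinuousLinearMap.inl ℝ G G) 1 :=
    (hasFDerivAt_id (1 : G)).prodMk (hasFDerivAt_const (1 : G) 1)
  have h2 := (HasFDerivAt.comp (f := fun p : G => (p, (1 : G))) 1 h.hasFDerivAt h1).clm_comp
    (hasFDerivAt_const (ContinuousLinearMap.inr ℝ G G) 1)
  have h3 := DFunLike.congr_fun (DFunLike.congr_fun
    ((hasFDerivAt_leftFrame (1 : G)).unique h2) x) w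
  simpa using h3

/-- Both the left frame and the right translations at 1 are governed by the mixed second derivative
of the product; its symmetry exchanges the two arguments. -/
theorem hasFDerivAt_rightDiff_one : HasFDerivAt (fun b : G => rightDiff 1 b)
    ((fderiv ℝ leftFrame (1 : G)).flip) 1 := by
  have h := (contDiff_fderiv_mulFun (G := G)).differentiable (by simp) (1, 1)
  have h1 : HasFDerivAt (fun p : G => ((1 : G), p)) (ContinuousLinearMap.inr ℝ G G) 1 :=
    (hasFDerivAt_const (1 : G) 1).prodMk (hasFDerivAt_id (1 : G))
  have h2 := (HasFDerivAt.comp (f := fun p : G => ((1 : G), p)) 1 h.hasFDerivAt h1).clm_comp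
    (hasFDerivAt_const (ContinuousLinearMap.inl ℝ G G) 1)
  convert! h2 using 1
  ext x w
  have hs : IsSymmSndFDerivAt ℝ (mulFun G) (1, 1) :=
    (contDiff_mulFun (G := G)).contDiffAt.isSymmSndFDerivAt (by
      rw [minSmoothness_of_isRCLikeNormedField]
      exact WithTop.coe_le_coe.2 le_top)
  simp [fderiv_leftFrame_one_eq, hs.eq (w, 0) (0, x)]

theorem hasDerivAt_leftCoframe_rightDiff {γ : ℝ → G} {u : G} (h1 : HasDerivAt γ u 0)
    (h0 : γ 0 = 1) (w : G) :
    HasDerivAt (fun t : ℝ => leftCoframe (γ t) (rightDiff 1 (γ t) w)) (lieBr w u) 0 := by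
  have h2 : HasFDerivAt leftCoframe (fderiv ℝ leftCoframe (1 : G)) (γ 0) := by
    rw [h0]; exact hasFDerivAt_leftCoframe 1
  have h3 : HasFDerivAt (fun b : G => rightDiff 1 b) ((fderiv ℝ leftFrame (1 : G)).flip) (γ 0) := by
    rw [h0]; exact hasFDerivAt_rightDiff_one
  have h2' := h2.comp_hasDerivAt 0 h1
  have h3' := h3.comp_hasDerivAt 0 h1
  have h4 := h2'.clm_apply (h3'.clm_apply (hasDerivAt_const 0 w))
  have h5 := leftFrame_fderiv_leftCoframe (1 : G) u w
  rw [leftFrame_one, leftCoframe_one, ContinuousLinearMap.id_apply,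
    ContinuousLinearMap.id_apply] at h5
  refine h4.congr_deriv ?_
  simp only [Function.comp_def, h0, leftCoframe_one, rightDiff_one_right,
    ContinuousLinearMap.id_apply, ContinuousLinearMap.flip_apply, lieBr,
    eq_neg_of_add_eq_zero_right h5, add_zero]
  abel

theorem hasDerivAt_groupAd_smul
    (hexp : ∀ (s t : ℝ) (x : G), (s • x) * (t • x) = (s + t) • x) (x w : G) :
    HasDerivAt (fun t : ℝ => groupAd (t • x) w) (lieBr x w) 0 := by
  have hinv : ∀ t : ℝ, (t • x)⁻¹ = -(t • x) := fun t => by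
    rw [inv_eq_iff_mul_eq_one, ← neg_smul, hexp, add_neg_cancel, zero_smul,
      one_eq_zero_of_smul_mul_smul hexp]
  have h1 : HasDerivAt (fun t : ℝ => -(t • x)) (-x) 0 := by
    simpa using ((hasDerivAt_id (0 : ℝ)).smul_const x).fun_neg
  have h := hasDerivAt_leftCoframe_rightDiff h1 (by simp [one_eq_zero_of_smul_mul_smul hexp]) w
  refine (h.congr_deriv ?_).congr_of_eventuallyEq (Filter.Eventually.of_forall fun t => ?_)
  · simp [lieBr]; abel
  · simp only [groupAd_eq, hinv, ContinuousLinearMap.comp_apply]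

variable {ι : Type*} {e : ι → G} {r s : ℝ}

theorem inv_mem_ccBall (hexp : ∀ (s t : ℝ) (x : G), (s • x) * (t • x) = (s + t) • x)
    {g : G} (hg : g ∈ ccBall e r) : g⁻¹ ∈ ccBall e r := by
  have hinv : ∀ (t : ℝ) (x : G), (t • x)⁻¹ = -t • x := fun t x => by
    rw [inv_eq_iff_mul_eq_one, hexp, add_neg_cancel, zero_smul,
      one_eq_zero_of_smul_mul_smul hexp]
  obtain ⟨l, h1, rfl⟩ := hg
  refine ⟨(l.map fun a => (a.1, -a.2)).reverse, ?_, ?_⟩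
  · simpa [List.sum_reverse, Function.comp_def] using h1
  · rw [List.prod_inv_reverse]
    simp [Function.comp_def, hinv]

/-- The spanning set is permuted into itself, since Ad h ∘ Ad g = Ad (hg) and words can be
concatenated. -/
theorem groupAd_mem_span (W : Submodule ℝ G)
    (hW : W = Submodule.span ℝ {z | ∃ h, (∃ r, h ∈ ccBall e r) ∧ ∃ i, groupAd h (e i) = z})
    {h : G} {r : ℝ} (hh : h ∈ ccBall e r) {w : G} (hw : w ∈ W) : groupAd h w ∈ W := by
  subst hW
  induction hw using Submodule.span_induction with
  | mem x hx =>
    obtain ⟨g, ⟨s, hg⟩, i, rfl⟩ := hx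
    refine Submodule.subset_span ⟨h * g, ⟨r + s, mul_mem_ccBall hh hg⟩, i, ?_⟩
    rw [groupAd_mul]; rfl
  | zero => simp
  | add x y _ _ hx hy => rw [map_add]; exact add_mem hx hy
  | smul c x _ hx => rw [map_smul]; exact Submodule.smul_mem _ _ hx

/-- The bracket with `e i` is the derivative at t = 0 of Ad (t • e i), which preserves `W`; the
difference quotients stay in `W`, and `W` is closed. -/
theorem lieBr_mem_span [FiniteDimensional ℝ G]
    (hexp : ∀ (s t : ℝ) (x : G), (s • x) * (t • x) = (s + t) • x) (W : Submodule ℝ G)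
    (hW : W = Submodule.span ℝ {z | ∃ h, (∃ r, h ∈ ccBall e r) ∧ ∃ i, groupAd h (e i) = z})
    (i : ι) {w : G} (hw : w ∈ W) : lieBr (e i) w ∈ W := by
  have h := (hasDerivAt_groupAd_smul hexp (e i) w).tendsto_slope_zero
  refine (Submodule.closed_of_finiteDimensional W).mem_of_tendsto h
    (Filter.Eventually.of_forall fun t => ?_)
  refine W.smul_mem _ (W.sub_mem ?_ ?_)
  · exact groupAd_mem_span W hW (smul_mem_ccBall i _) hw
  · exact groupAd_mem_span W hW (smul_mem_ccBall i 0) hw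

/-- The tangent directions at the neutral element of smooth families of elements of the subgroup
generated by the `t • e i`. -/
def IsReachable (e : ι → G) (V : Submodule ℝ G) : Prop :=
  ∃ (E : Type) (_ : NormedAddCommGroup E) (_ : NormedSpace ℝ E) (_ : CompleteSpace E) (F : E → G),
    ContDiff ℝ ∞ F ∧ F 0 = 1 ∧ (∀ v ∈ V, ∃ u, fderiv ℝ F 0 u = v) ∧
      ∃ C, ∀ x, ‖x‖ ≤ 1 → F x ∈ ccBall e C

theorem isReachable_bot : IsReachable e (⊥ : Submodule ℝ G) :=
  ⟨ℝ, inferInstance, inferInstance, inferInstance, fun _ => 1, contDiff_const, rfl,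
    fun v hv => ⟨0, by simp_all⟩, 0, fun _ _ => one_mem_ccBall le_rfl⟩

/-- Multiply the two families pointwise: the differential of the product at (1, 1) is addition, so
the tangent directions add up. -/
theorem IsReachable.sup {V W : Submodule ℝ G} (hV : IsReachable e V) (hW : IsReachable e W) :
    IsReachable e (V ⊔ W) := by
  obtain ⟨E, _, _, _, F, hF, hF0, hFV, C, hC⟩ := hV
  obtain ⟨E', _, _, _, F', hF', hF0', hFV', C', hC'⟩ := hW
  refine ⟨E × E', inferInstance, inferInstance, inferInstance, fun z => F z.1 * F' z.2,
    (hF.comp contDiff_fst).groupMul (n := ⊤) (hF'.comp contDiff_snd), by simp [hF0, hF0'], ?_,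
    C + C', fun z hz => mul_mem_ccBall (hC _ ((norm_fst_le z).trans hz))
      (hC' _ ((norm_snd_le z).trans hz))⟩
  have hd : HasFDerivAt (fun z : E × E' => F z.1 * F' z.2)
      ((fderiv ℝ (mulFun G) (1, 1)).comp
        (((fderiv ℝ F 0).comp (ContinuousLinearMap.fst ℝ E E')).prod
          ((fderiv ℝ F' 0).comp (ContinuousLinearMap.snd ℝ E E')))) 0 := by
    have h1 : HasFDerivAt (fun z : E × E' => F z.1)
        ((fderiv ℝ F 0).comp (ContinuousLinearMap.fst ℝ E E')) 0 :=
      HasFDerivAt.comp (f := Prod.fst) (0 : E × E')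
        (hF.differentiable (by simp) _).hasFDerivAt hasFDerivAt_fst
    have h2 : HasFDerivAt (fun z : E × E' => F' z.2)
        ((fderiv ℝ F' 0).comp (ContinuousLinearMap.snd ℝ E E')) 0 :=
      HasFDerivAt.comp (f := Prod.snd) (0 : E × E')
        (hF'.differentiable (by simp) _).hasFDerivAt hasFDerivAt_snd
    have h3 : HasFDerivAt (mulFun G) (fderiv ℝ (mulFun G) (1, 1))
        (F (0 : E × E').1, F' (0 : E × E').2) := by
      simp only [Prod.fst_zero, Prod.snd_zero, hF0, hF0']
      exact hasFDerivAt_mulFun _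
    exact HasFDerivAt.comp (f := fun z : E × E' => (F z.1, F' z.2)) 0 h3 (h1.prodMk h2)
  rw [hd.fderiv]
  intro v hv
  obtain ⟨a, ha, b, hb, rfl⟩ := Submodule.mem_sup.1 hv
  obtain ⟨u, rfl⟩ := hFV a ha
  obtain ⟨u', rfl⟩ := hFV' b hb
  refine ⟨(u, u'), ?_⟩
  have e : ((fderiv ℝ F 0 u, fderiv ℝ F' 0 u') : G × G) =
      ContinuousLinearMap.inl ℝ G G (fderiv ℝ F 0 u) +
        ContinuousLinearMap.inr ℝ G G (fderiv ℝ F' 0 u') := by simp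
  have e1 := DFunLike.congr_fun (rightDiff_one_right (1 : G)) (fderiv ℝ F 0 u)
  have e2 := DFunLike.congr_fun (leftDiff_one_left (1 : G)) (fderiv ℝ F' 0 u')
  simp only [ContinuousLinearMap.comp_apply, ContinuousLinearMap.prod_apply,
    ContinuousLinearMap.coe_fst', ContinuousLinearMap.coe_snd', e, map_add]
  exact congrArg₂ (· + ·) e1 e2

/-- The conjugates h · (t • e i) · h⁻¹ have velocity Ad h (e i) at t = 0 and, for |t| ≤ 1, word
length at most r + 1 + r. -/
theorem isReachable_span_groupAd
    (hexp : ∀ (s t : ℝ) (x : G), (s • x) * (t • x) = (s + t) • x) {h : G} {r : ℝ}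
    (hh : h ∈ ccBall e r) (i : ι) : IsReachable e (Submodule.span ℝ {groupAd h (e i)}) := by
  have h0 : (0 : ℝ) • e i = 1 := by simp [one_eq_zero_of_smul_mul_smul hexp]
  refine ⟨ℝ, inferInstance, inferInstance, inferInstance, fun t => h * t • e i * h⁻¹, ?_, ?_, ?_,
    r + 1 + r, ?_⟩
  · exact ContDiff.groupMul (n := ⊤) (ContDiff.groupMul (n := ⊤) contDiff_const (by fun_prop))
      contDiff_const
  · simp [h0]
  · intro v hv
    obtain ⟨c, rfl⟩ := Submodule.mem_span_singleton.1 hv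
    have h1 : HasDerivAt (fun s : ℝ => s • e i) (e i) 0 := by
      simpa using (hasDerivAt_id (0 : ℝ)).smul_const (e i)
    have h2 : HasFDerivAt (fun y : G => h * y * h⁻¹) (groupAd h) ((0 : ℝ) • e i) := by
      rw [h0]; exact hasFDerivAt_conj h
    have h3 := h2.comp_hasDerivAt 0 h1
    refine ⟨c, ?_⟩
    erw [h3.hasFDerivAt.fderiv]
    simp
  · intro t ht
    exact mul_mem_ccBall (mul_mem_ccBall hh (ccBall_mono ht (smul_mem_ccBall i t)))
      (inv_mem_ccBall hexp hh)

/-- A family with surjective differential at 0 maps neighborhoods of 0 onto neighborhoods of 1. -/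
theorem IsReachable.exists_ccBall_mem_nhds [CompleteSpace G] (h : IsReachable e (⊤ : Submodule ℝ G)) :
    ∃ C, ccBall e C ∈ 𝓝 (1 : G) := by
  obtain ⟨E, _, _, _, F, hF, hF0, hFV, C, hC⟩ := h
  refine ⟨C, ?_⟩
  have h1 : HasStrictFDerivAt F (fderiv ℝ F 0) 0 := hF.contDiffAt.hasStrictFDerivAt (by simp)
  have h2 := h1.map_nhds_eq_of_surj (LinearMap.range_eq_top.2 fun v => hFV v trivial)
  rw [hF0] at h2
  rw [← h2, Filter.mem_map]
  refine Filter.mem_of_superset (Metric.closedBall_mem_nhds (0 : E) one_pos) fun x hx => ?_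
  exact hC x (by simpa using hx)

end Chow

namespace CarnotGroup

/-! ### Topology of the balls, and their behavior under dilation -/

section Balls

variable {G : Type*} [NormedAddCommGroup G] [NormedSpace ℝ G] [FiniteDimensional ℝ G] [Group G]
  [LieGroup 𝓘(ℝ, G) ∞ G] (𝒢 : CarnotGroup G) {d : ℕ}

theorem exists_norm_mul_sub_le :
    ∃ M : ℝ, 0 ≤ M ∧ ∀ p x : G, ‖p‖ ≤ 1 → ‖x‖ ≤ 1 → ‖p * x - p * 0‖ ≤ M * ‖x‖ := by
  obtain ⟨M, hM⟩ := ((isCompact_closedBall (0 : G) 1).prod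
    (isCompact_closedBall (0 : G) 1)).exists_bound_of_continuousOn
      (contDiff_leftDiff (G := G)).continuous.continuousOn
  refine ⟨M, (norm_nonneg _).trans (hM (0, 0) (by simp)), fun p x hp hx => ?_⟩
  have h := (convex_closedBall (0 : G) 1).norm_image_sub_le_of_norm_hasFDerivWithin_le
    (f := fun y => p * y) (f' := fun y => leftDiff p y) (x := 0) (y := x) (C := M)
    (fun y _ => (hasFDerivAt_mul_left p y).hasFDerivWithinAt)
    (fun y hy => hM (p, y) ⟨by simpa using hp, hy⟩) (by simp) (by simpa using hx)
  simpa using h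

/-- The basis of the first layer, as a family of elements of `G`. -/
noncomputable def horizontal (X : Module.Basis (Fin d) ℝ (𝒢.layer 1)) (i : Fin d) : G :=
  (X i : GroupLieAlgebra 𝓘(ℝ, G) G)

variable (X : Module.Basis (Fin d) ℝ (𝒢.layer 1))

theorem span_horizontal : Submodule.span ℝ (Set.range (𝒢.horizontal X)) = 𝒢.stratum 1 := by
  have h := congrArg (Submodule.map (𝒢.layer 1).subtype) X.span_eq
  rw [Submodule.map_span, ← Set.range_comp, Submodule.map_top, Submodule.range_subtype] at h
  exact h

theorem horizontal_mem (i : Fin d) : 𝒢.horizontal X i ∈ 𝒢.stratum 1 := (X i).2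

theorem dil_horizontal (s : ℝ) (i : Fin d) :
    𝒢.dil s (𝒢.horizontal X i) = s • 𝒢.horizontal X i := by
  rw [𝒢.dil_of_mem le_rfl (by omega) (𝒢.horizontal_mem X i), pow_one]

theorem dil_list_prod (s : ℝ) (l : List G) : 𝒢.dil s l.prod = (l.map (𝒢.dil s)).prod := by
  induction l with
  | nil => simp [dil_one_right]
  | cons a l ih => simp [dil_mul, ih]

theorem dil_mem_ccBall {s r : ℝ} (hs : 0 ≤ s) {g : G} (hg : g ∈ ccBall (𝒢.horizontal X) r) :
    𝒢.dil s g ∈ ccBall (𝒢.horizontal X) (s * r) := by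
  obtain ⟨l, h1, rfl⟩ := hg
  refine ⟨l.map fun a => (a.1, s * a.2), ?_, ?_⟩
  · simp only [List.map_map, Function.comp_def, abs_mul, abs_of_nonneg hs, List.sum_map_mul_left]
    gcongr
  · rw [dil_list_prod]
    simp only [List.map_map, Function.comp_def, map_smul, dil_horizontal, smul_smul, mul_comm s]

theorem mem_ccBall_of_dil_mem {s r : ℝ} (hs : 0 < s) {g : G}
    (hg : 𝒢.dil s g ∈ ccBall (𝒢.horizontal X) (s * r)) : g ∈ ccBall (𝒢.horizontal X) r := by
  have h := 𝒢.dil_mem_ccBall X (inv_nonneg.2 hs.le) hg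
  rwa [𝒢.dil_inv_dil hs.ne', inv_mul_cancel_left₀ hs.ne'] at h

/-- Each letter of a word moves the point by at most `M` times its norm as long as the point stays
in the unit ball. For small `r` the sum of these moves stays below 1, so induction on the word
closes up. -/
theorem exists_ccBall_subset_closedBall :
    ∃ r > 0, ccBall (𝒢.horizontal X) r ⊆ Metric.closedBall 0 1 := by
  obtain ⟨M, hM0, hM⟩ := exists_norm_mul_sub_le (G := G)
  set E : ℝ := ∑ i, ‖𝒢.horizontal X i‖ with hE
  have hE0 : 0 ≤ E := Finset.sum_nonneg fun i _ => norm_nonneg _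
  have hEi : ∀ i, ‖𝒢.horizontal X i‖ ≤ E := fun i =>
    Finset.single_le_sum (f := fun i => ‖𝒢.horizontal X i‖) (fun i _ => norm_nonneg _)
      (Finset.mem_univ i)
  -- This makes both r E ≤ 1, so that single letters stay in the unit ball, and M r E ≤ 1, so that
  -- all partial products do.
  set r : ℝ := ((M + 1) * (E + 1))⁻¹ with hr
  have hr0 : 0 < r := by positivity
  have hrE : r * E ≤ 1 := by
    rw [hr, inv_mul_le_iff₀ (by positivity)]; nlinarith [mul_nonneg hM0 hE0]
  have hrME : M * (r * E) ≤ 1 := by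
    rw [hr, mul_left_comm, inv_mul_le_iff₀ (by positivity)]; nlinarith [mul_nonneg hM0 hE0]
  refine ⟨r, hr0, ?_⟩
  rintro g ⟨l, hl, rfl⟩
  have key : ∀ l : List (Fin d × ℝ), (l.map fun a => |a.2|).sum ≤ r →
      ‖(l.map fun a => a.2 • 𝒢.horizontal X a.1).prod‖ ≤
        M * ((l.map fun a => |a.2|).sum * E) := by
    intro l
    induction l using List.reverseRecOn with
    | nil => simp [𝒢.one_eq_zero]
    | append_singleton l a ih =>
      intro hl
      simp only [List.map_append, List.map_cons, List.map_nil, List.sum_append, List.sum_cons,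
        List.sum_nil, add_zero, List.prod_append, List.prod_cons, List.prod_nil, mul_one] at hl ⊢
      have hs : 0 ≤ (l.map fun a => |a.2|).sum :=
        List.sum_nonneg (by simp only [List.mem_map]; rintro _ ⟨a, _, rfl⟩; exact abs_nonneg _)
      have ih := ih (by linarith [abs_nonneg a.2])
      set p := (l.map fun a => a.2 • 𝒢.horizontal X a.1).prod
      set σ := (l.map fun a => |a.2|).sum
      have hσ : σ ≤ r := by linarith [abs_nonneg a.2]
      have ha : |a.2| ≤ r := by linarith
      have hx : ‖a.2 • 𝒢.horizontal X a.1‖ ≤ |a.2| * E := by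
        rw [norm_smul, Real.norm_eq_abs]; gcongr; exact hEi _
      have h1 := hM p (a.2 • 𝒢.horizontal X a.1)
        (ih.trans (le_trans (by gcongr) hrME))
        (hx.trans (le_trans (by gcongr) hrE))
      rw [← 𝒢.one_eq_zero, mul_one] at h1
      calc ‖p * a.2 • 𝒢.horizontal X a.1‖
          ≤ ‖p * a.2 • 𝒢.horizontal X a.1 - p‖ + ‖p‖ := by
            simpa using norm_add_le (p * a.2 • 𝒢.horizontal X a.1 - p) p
        _ ≤ M * (|a.2| * E) + M * (σ * E) := by
            refine add_le_add (h1.trans ?_) ih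
            gcongr
        _ = M * ((σ + |a.2|) * E) := by ring
  rw [mem_closedBall_zero_iff]
  refine (key l hl).trans (le_trans ?_ hrME)
  gcongr

theorem isBounded_ccBall (r : ℝ) : Bornology.IsBounded (ccBall (𝒢.horizontal X) r) := by
  obtain ⟨r₀, hr₀, h⟩ := 𝒢.exists_ccBall_subset_closedBall X
  have hr1 : 0 < |r| + 1 := by positivity
  have hs : 0 < r₀ / (|r| + 1) := by positivity
  have hb : Bornology.IsBounded (𝒢.dil (r₀ / (|r| + 1))⁻¹ '' Metric.closedBall 0 1) :=
    (((isCompact_closedBall (0 : G) 1).image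
      (𝒢.dil (r₀ / (|r| + 1))⁻¹).continuous)).isBounded
  refine hb.subset fun g hg => ⟨𝒢.dil (r₀ / (|r| + 1)) g, h ?_, 𝒢.dil_inv_dil hs.ne' g⟩
  refine ccBall_mono ?_ (𝒢.dil_mem_ccBall X hs.le hg)
  rw [div_mul_eq_mul_div, div_le_iff₀ hr1]
  nlinarith [le_abs_self r]

/-- The span of all Ad h (X i) contains the first layer and is stable under brackets with it, hence
contains every layer. Finitely many of these vectors suffice, and their families are multiplied
together. -/
theorem isReachable_top : IsReachable (𝒢.horizontal X) (⊤ : Submodule ℝ G) := by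
  set S : Set G := {z | ∃ h, (∃ r, h ∈ ccBall (𝒢.horizontal X) r) ∧
    ∃ i, groupAd h (𝒢.horizontal X i) = z} with hS
  have hW : Submodule.span ℝ S = ⊤ := by
    have h1 : 𝒢.stratum 1 ≤ Submodule.span ℝ S := by
      rw [← 𝒢.span_horizontal X, Submodule.span_le]
      rintro _ ⟨i, rfl⟩
      exact Submodule.subset_span ⟨1, ⟨0, one_mem_ccBall le_rfl⟩, i, by rw [groupAd_one]; rfl⟩
    have h2 : ∀ r, 1 ≤ r → r ≤ 𝒢.step → 𝒢.stratum r ≤ Submodule.span ℝ S := by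
      intro r hr
      induction r, hr using Nat.le_induction with
      | base => intro _; exact h1
      | succ r hr ih =>
        intro hr2
        rw [𝒢.stratum_succ r hr (by omega), Submodule.span_le]
        rintro _ ⟨x, hx, y, hy, rfl⟩
        have hy' := ih (by omega) hy
        rw [← 𝒢.span_horizontal X] at hx
        rw [SetLike.mem_coe]
        induction hx using Submodule.span_induction with
        | mem x hx =>
          obtain ⟨i, rfl⟩ := hx
          exact lieBr_mem_span 𝒢.smul_mul_smul _ rfl i hy'
        | zero => rw [lieBr_zero_left]; exact zero_mem _
        | add a b _ _ ha hb => rw [lieBr_add_left]; exact add_mem ha hb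
        | smul c a _ ha => rw [lieBr_smul_left]; exact Submodule.smul_mem _ _ ha
    rw [eq_top_iff, ← 𝒢.iSup_stratum]
    exact iSup_le fun r => h2 _ (by omega) (by omega)
  obtain ⟨T, hTS, hT⟩ := (Submodule.fg_span_iff_fg_span_finset_subset S).1
    (by rw [hW]; exact Module.Finite.fg_top)
  rw [← hW, hT]
  clear hT
  classical
  induction T using Finset.induction_on with
  | empty => simpa using isReachable_bot
  | insert a T _ ih =>
    rw [Finset.coe_insert, Set.insert_subset_iff] at hTS
    rw [Finset.coe_insert, Submodule.span_insert]
    obtain ⟨h, ⟨r, hh⟩, i, rfl⟩ := hTS.1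
    exact (isReachable_span_groupAd 𝒢.smul_mul_smul hh i).sup (ih hTS.2)

/-- Some ball is a neighborhood of 1, and dilations, being homeomorphisms fixing 1, carry this over
to every positive radius. -/
theorem ccBall_mem_nhds {r : ℝ} (hr : 0 < r) : ccBall (𝒢.horizontal X) r ∈ 𝓝 (1 : G) := by
  obtain ⟨C, hC⟩ := (𝒢.isReachable_top X).exists_ccBall_mem_nhds
  have hC1 : 0 < |C| + 1 := by positivity
  have hs : 0 < r / (|C| + 1) := by positivity
  have ht : Filter.Tendsto (𝒢.dil (r / (|C| + 1))⁻¹) (𝓝 1) (𝓝 1) := by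
    have := (𝒢.dil (r / (|C| + 1))⁻¹).continuous.tendsto 1
    rwa [dil_one_right] at this
  filter_upwards [ht hC] with g hg
  have h := 𝒢.dil_mem_ccBall X hs.le hg
  rw [𝒢.dil_dil_inv hs.ne'] at h
  refine ccBall_mono ?_ h
  rw [div_mul_eq_mul_div, div_le_iff₀ hC1]
  nlinarith [le_abs_self C]

theorem mem_interior_ccBall_mul {g h : G} {r s : ℝ} (hg : g ∈ ccBall (𝒢.horizontal X) r)
    (hh : h ∈ interior (ccBall (𝒢.horizontal X) s)) :
    g * h ∈ interior (ccBall (𝒢.horizontal X) (r + s)) := by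
  have := topologicalGroup_of_lieGroup 𝓘(ℝ, G) ∞ (G := G)
  have h1 : IsOpen ((g * ·) '' interior (ccBall (𝒢.horizontal X) s)) :=
    (Homeomorph.mulLeft g).isOpenMap _ isOpen_interior
  refine interior_maximal ?_ h1 ⟨h, hh, rfl⟩
  rintro _ ⟨k, hk, rfl⟩
  exact mul_mem_ccBall hg (interior_subset hk)

theorem ccBall_subset_interior {r s : ℝ} (h : r < s) :
    ccBall (𝒢.horizontal X) r ⊆ interior (ccBall (𝒢.horizontal X) s) := by
  intro g hg
  have h1 := 𝒢.mem_interior_ccBall_mul X hg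
    (mem_interior_iff_mem_nhds.2 (𝒢.ccBall_mem_nhds X (sub_pos.2 h)))
  simpa using h1

theorem closure_ccBall_subset {r s : ℝ} (h : r < s) :
    closure (ccBall (𝒢.horizontal X) r) ⊆ ccBall (𝒢.horizontal X) s := by
  have := topologicalGroup_of_lieGroup 𝓘(ℝ, G) ∞ (G := G)
  intro g hg
  have h1 : (fun y => y⁻¹ * g) ⁻¹' ccBall (𝒢.horizontal X) (s - r) ∈ 𝓝 g := by
    have hc : Continuous fun y : G => y⁻¹ * g := by fun_prop
    have := hc.tendsto g
    rw [inv_mul_cancel] at this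
    exact this (𝒢.ccBall_mem_nhds X (sub_pos.2 h))
  obtain ⟨y, hy1, hy2⟩ := mem_closure_iff_nhds.1 hg _ h1
  simpa using mul_mem_ccBall hy2 hy1

theorem image_dil_interior_ccBall {s r : ℝ} (hs : 0 < s) :
    𝒢.dil s '' interior (ccBall (𝒢.horizontal X) r) =
      interior (ccBall (𝒢.horizontal X) (s * r)) := by
  let D : G ≃ₜ G :=
    { toFun := 𝒢.dil s
      invFun := 𝒢.dil s⁻¹
      left_inv := 𝒢.dil_inv_dil hs.ne'
      right_inv := 𝒢.dil_dil_inv hs.ne'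
      continuous_toFun := (𝒢.dil s).continuous
      continuous_invFun := (𝒢.dil s⁻¹).continuous }
  change D '' _ = _
  rw [D.image_interior]
  congr 1
  ext g
  constructor
  · rintro ⟨h, hh, rfl⟩
    exact 𝒢.dil_mem_ccBall X hs.le hh
  · intro hg
    refine ⟨𝒢.dil s⁻¹ g, ?_, 𝒢.dil_dil_inv hs.ne' g⟩
    refine 𝒢.mem_ccBall_of_dil_mem X hs ?_
    rwa [𝒢.dil_dil_inv hs.ne']

end Balls

end CarnotGroup

namespace CarnotGroup

/-! ### Volume bound for disjoint translates of the unit ball -/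

section Packing

variable {G : Type*} [NormedAddCommGroup G] [NormedSpace ℝ G] [FiniteDimensional ℝ G] [Group G]
  [LieGroup 𝓘(ℝ, G) ∞ G] (𝒢 : CarnotGroup G) {d : ℕ}
  (X : Module.Basis (Fin d) ℝ (𝒢.layer 1))

open MeasureTheory in
theorem half_measure_le_measure_translate [MeasurableSpace G] [BorelSpace G] (μ : Measure G)
    [μ.IsAddHaarMeasure] (z : G) {S : Set G} (hS : MeasurableSet S)
    (h : ∀ x ∈ S, 1 / 2 ≤ |(leftDiff z x).det|) :
    ENNReal.ofReal (1 / 2) * μ S ≤ μ ((z * ·) '' S) := by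
  rw [← lintegral_abs_det_fderiv_eq_addHaar_image μ hS
    (fun x _ => (hasFDerivAt_mul_left z x).hasFDerivWithinAt) (mul_right_injective z).injOn]
  rw [← setLIntegral_const]
  exact setLIntegral_mono_ae' hS (Filter.Eventually.of_forall fun x hx =>
    ENNReal.ofReal_le_ofReal (h x hx))

/-- Invariance of Lebesgue measure under the group law is not used. Near the identity the Jacobians
of left translations are at least 1/2, and a dilation brings a bounded configuration there. -/
theorem exists_dil_det_le (r : ℝ) : ∃ s > 0, ∀ y ∈ ccBall (𝒢.horizontal X) r,
    ∀ x ∈ ccBall (𝒢.horizontal X) r, 1 / 2 ≤ |(leftDiff (𝒢.dil s y) (𝒢.dil s x)).det| := by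
  have hc : Continuous fun z : G × G => |(leftDiff z.1 z.2).det| :=
    (ContinuousLinearMap.continuous_det.comp (contDiff_leftDiff (G := G)).continuous).abs
  have h1 : |(leftDiff (0 : G) 0).det| = 1 := by
    rw [← 𝒢.one_eq_zero, leftDiff_one_left]
    exact (congrArg abs LinearMap.det_id).trans abs_one
  have h2 : ∀ᶠ z : G × G in 𝓝 0, 1 / 2 < |(leftDiff z.1 z.2).det| :=
    hc.continuousAt.eventually_const_lt (by
      change 1 / 2 < |(leftDiff (0 : G) 0).det|
      rw [h1]; norm_num)
  obtain ⟨ε, hε, hball⟩ := Metric.eventually_nhds_iff.1 h2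
  obtain ⟨R, hR0, hR⟩ := (𝒢.isBounded_ccBall X r).exists_pos_norm_le
  have h3 : Filter.Tendsto (fun s => ‖𝒢.dil s‖) (𝓝 0) (𝓝 0) := by
    have := 𝒢.continuous_dil.norm.tendsto 0
    rwa [dil_zero, norm_zero] at this
  have h4 : ∀ᶠ s in 𝓝[>] (0 : ℝ), ‖𝒢.dil s‖ < ε / R :=
    (h3.mono_left nhdsWithin_le_nhds).eventually_lt_const (by positivity)
  obtain ⟨s, hs, hs0⟩ := (h4.and self_mem_nhdsWithin).exists
  have h5 : ∀ y ∈ ccBall (𝒢.horizontal X) r, ‖𝒢.dil s y‖ < ε := fun y hy => by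
    calc ‖𝒢.dil s y‖ ≤ ‖𝒢.dil s‖ * ‖y‖ := (𝒢.dil s).le_opNorm y
      _ ≤ ‖𝒢.dil s‖ * R := by gcongr; exact hR y hy
      _ < ε / R * R := by gcongr
      _ = ε := div_mul_cancel₀ _ hR0.ne'
  refine ⟨s, hs0, fun y hy x hx => (hball (y := (𝒢.dil s y, 𝒢.dil s x)) ?_).le⟩
  rw [dist_zero_right, Prod.norm_mk]
  exact max_lt (h5 y hy) (h5 x hx)

open MeasureTheory in
-- Move `q` to 1 and shrink by `s`. The disjoint translates then each have at least half the volume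
-- s^n μ(B) and lie in a ball of volume (s (r + 2))^n μ(B); the 2 in the bound is the price of the
-- Jacobians.
theorem card_le_of_pairwiseDisjoint {r : ℝ} (hr : 0 ≤ r) (q : G) (T : Finset G)
    (hT : ∀ g ∈ T, q⁻¹ * g ∈ ccBall (𝒢.horizontal X) r)
    (hd : (T : Set G).PairwiseDisjoint
      fun g => (g * ·) '' interior (ccBall (𝒢.horizontal X) 1)) :
    (T.card : ℝ) ≤ 2 * (r + 2) ^ 𝒢.hausdorffDim := by
  let : MeasurableSpace G := borel G
  have : BorelSpace G := ⟨rfl⟩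
  have := topologicalGroup_of_lieGroup 𝓘(ℝ, G) ∞ (G := G)
  let μ : Measure G := Measure.addHaar
  obtain ⟨s, hs, hdet⟩ := 𝒢.exists_dil_det_le X (r + 1)
  set B := interior (ccBall (𝒢.horizontal X) 1) with hB
  have hscale : ∀ t > 0, ∀ S : Set G, μ (𝒢.dil t '' S) =
      ENNReal.ofReal (t ^ 𝒢.hausdorffDim) * μ S := fun t ht S => by
    rw [Measure.addHaar_image_continuousLinearMap,
      show LinearMap.det (𝒢.dil t).toLinearMap = _ from 𝒢.det_dil t, abs_of_pos (pow_pos ht _)]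
  have hB0 : μ B ≠ 0 := (isOpen_interior.measure_pos μ
    ⟨1, mem_interior_iff_mem_nhds.2 (𝒢.ccBall_mem_nhds X one_pos)⟩).ne'
  have hBtop : μ B ≠ ⊤ := ((𝒢.isBounded_ccBall X 1).subset interior_subset).measure_lt_top.ne
  set S := 𝒢.dil s '' B with hS
  have hSopen : IsOpen S := by
    rw [hS, hB, 𝒢.image_dil_interior_ccBall X hs]; exact isOpen_interior
  let tr : G → Set G := fun g => (𝒢.dil s (q⁻¹ * g) * ·) '' S
  have htr_open : ∀ g, IsOpen (tr g) := fun g =>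
    (Homeomorph.mulLeft (𝒢.dil s (q⁻¹ * g))).isOpenMap _ hSopen
  have htr_eq : ∀ g, tr g = (fun y => 𝒢.dil s (q⁻¹ * y)) '' ((g * ·) '' B) := fun g => by
    simp only [tr, hS, Set.image_image, dil_mul, mul_assoc]
  have hinj : Function.Injective fun y => 𝒢.dil s (q⁻¹ * y) := fun a b hab => by
    have := congrArg (𝒢.dil s⁻¹) hab
    simp only [𝒢.dil_inv_dil hs.ne'] at this
    exact mul_left_cancel this
  have htr_disj : (T : Set G).PairwiseDisjoint tr := by
    intro a ha b hb hab
    have := hd ha hb hab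
    simp only [Function.onFun] at this ⊢
    rw [htr_eq, htr_eq]
    exact (Set.disjoint_image_iff hinj).2 this
  have htr_sub : ∀ g ∈ T, tr g ⊆ 𝒢.dil (s * (r + 2)) '' B := by
    intro g hg
    rw [htr_eq, Set.image_image, hB, 𝒢.image_dil_interior_ccBall X (by positivity)]
    rintro _ ⟨b, hb, rfl⟩
    have h1 := 𝒢.mem_interior_ccBall_mul X (hT g hg) hb
    have h2 : 𝒢.dil s (q⁻¹ * (g * b)) ∈ 𝒢.dil s '' interior (ccBall (𝒢.horizontal X) (r + 1)) :=
      ⟨_, h1, by rw [mul_assoc]⟩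
    rw [𝒢.image_dil_interior_ccBall X hs] at h2
    exact interior_mono (ccBall_mono (by nlinarith)) h2
  have htr_meas : ∀ g ∈ T, ENNReal.ofReal (1 / 2) * μ S ≤ μ (tr g) := by
    intro g hg
    refine half_measure_le_measure_translate μ _ hSopen.measurableSet ?_
    rintro _ ⟨b, hb, rfl⟩
    exact hdet _ (ccBall_mono (by linarith) (hT g hg)) _
      (ccBall_mono (by linarith) (interior_subset hb))
  have hsum : T.card * (ENNReal.ofReal (1 / 2) * μ S) ≤ μ (𝒢.dil (s * (r + 2)) '' B) := by
    calc (T.card : ENNReal) * (ENNReal.ofReal (1 / 2) * μ S)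
        = ∑ g ∈ T, ENNReal.ofReal (1 / 2) * μ S := by rw [Finset.sum_const, nsmul_eq_mul]
      _ ≤ ∑ g ∈ T, μ (tr g) := Finset.sum_le_sum htr_meas
      _ = μ (⋃ g ∈ T, tr g) :=
          (measure_biUnion_finset htr_disj fun g _ => (htr_open g).measurableSet).symm
      _ ≤ μ (𝒢.dil (s * (r + 2)) '' B) := measure_mono (Set.iUnion₂_subset htr_sub)
  rw [hS, hscale s hs, hscale (s * (r + 2)) (by positivity), ← mul_assoc, ← mul_assoc,
    ENNReal.mul_le_mul_iff_left hB0 hBtop, ← ENNReal.ofReal_natCast,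
    ← ENNReal.ofReal_mul (by positivity), ← ENNReal.ofReal_mul (by positivity),
    ENNReal.ofReal_le_ofReal_iff (by positivity), mul_pow] at hsum
  have hsn : 0 < s ^ 𝒢.hausdorffDim := pow_pos hs _
  refine le_of_mul_le_mul_right ?_ hsn
  linarith

end Packing

end CarnotGroup

namespace CarnotGroup

/-! ### Weighted bounds on horizontal derivatives and their calculus -/

section HorizontalCalculus

variable {G : Type*} [NormedAddCommGroup G] [NormedSpace ℝ G] [FiniteDimensional ℝ G] [Group G]
  [LieGroup 𝓘(ℝ, G) ∞ G] (𝒢 : CarnotGroup G) {d : ℕ}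
  (X : Module.Basis (Fin d) ℝ (𝒢.layer 1))
  {F F₁ F₂ : Type*} [NormedAddCommGroup F] [NormedSpace ℝ F] [NormedAddCommGroup F₁]
  [NormedSpace ℝ F₁] [NormedAddCommGroup F₂] [NormedSpace ℝ F₂]

/-- The derivative along the `i`-th horizontal field. -/
noncomputable def hderiv (i : Fin d) (f : G → F) (p : G) : F :=
  deriv (fun t : ℝ => f (p * t • 𝒢.horizontal X i)) 0

/-- Differentiability along the `i`-th horizontal field. -/
def HDifferentiable (i : Fin d) (f : G → F) : Prop :=
  ∀ p, DifferentiableAt ℝ (fun t : ℝ => f (p * t • 𝒢.horizontal X i)) 0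

theorem wordDeriv_cons (f : G → F) (i : Fin d) (w : List (Fin d)) :
    𝒢.wordDeriv X f (i :: w) = 𝒢.hderiv X i (𝒢.wordDeriv X f w) := rfl

theorem wordDeriv_append_singleton (f : G → F) (w : List (Fin d)) (i : Fin d) :
    𝒢.wordDeriv X f (w ++ [i]) = 𝒢.wordDeriv X (𝒢.hderiv X i f) w := by
  induction w with
  | nil => rfl
  | cons k w ih => rw [List.cons_append, wordDeriv_cons, ih, wordDeriv_cons]

variable {𝒢 X}

theorem HDifferentiable.hasDerivAt {i : Fin d} {f : G → F} (hf : 𝒢.HDifferentiable X i f) (p : G) :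
    HasDerivAt (fun t : ℝ => f (p * t • 𝒢.horizontal X i)) (𝒢.hderiv X i f p) 0 :=
  (hf p).hasDerivAt

theorem mul_zero_smul (𝒢 : CarnotGroup G) (p x : G) : p * (0 : ℝ) • x = p := by
  rw [zero_smul, ← 𝒢.one_eq_zero, mul_one]

theorem HDifferentiable.hasDerivAt' {i : Fin d} {f : G → F} (hf : 𝒢.HDifferentiable X i f) (p : G)
    (t : ℝ) : HasDerivAt (fun t : ℝ => f (p * t • 𝒢.horizontal X i))
      (𝒢.hderiv X i f (p * t • 𝒢.horizontal X i)) t := by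
  have h := hf.hasDerivAt (p * t • 𝒢.horizontal X i)
  rw [← sub_self t] at h
  have h2 := h.comp_sub_const t t
  simpa [mul_assoc, 𝒢.smul_mul_smul] using h2

variable (𝒢 X) in
/-- All horizontal derivatives of `f` of order at most `k` exist and are continuous, and those of
order `l` are bounded by `C * S (a + l)`. -/
def HBound (S : ℕ → ℝ) : ℕ → ℕ → ℝ → (G → F) → Prop
  | 0, a, C, f => Continuous f ∧ ∀ p, ‖f p‖ ≤ C * S a
  | k + 1, a, C, f => (Continuous f ∧ ∀ p, ‖f p‖ ≤ C * S a) ∧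
      ∀ i, 𝒢.HDifferentiable X i f ∧ HBound S k (a + 1) C (𝒢.hderiv X i f)

variable {S : ℕ → ℝ} {k a b J : ℕ} {C C' : ℝ}

theorem HBound.continuous {f : G → F} (hf : 𝒢.HBound X S k a C f) : Continuous f := by
  cases k with
  | zero => exact hf.1
  | succ k => exact hf.1.1

theorem HBound.norm_le {f : G → F} (hf : 𝒢.HBound X S k a C f) (p : G) : ‖f p‖ ≤ C * S a := by
  cases k with
  | zero => exact hf.2 p
  | succ k => exact hf.1.2 p

theorem HBound.mono (hS : ∀ i, 0 ≤ S i) (hC : C ≤ C') {f : G → F}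
    (hf : 𝒢.HBound X S k a C f) : 𝒢.HBound X S k a C' f := by
  induction k generalizing a f with
  | zero => exact ⟨hf.1, fun p => (hf.2 p).trans (mul_le_mul_of_nonneg_right hC (hS _))⟩
  | succ k ih =>
    exact ⟨⟨hf.1.1, fun p => (hf.1.2 p).trans (mul_le_mul_of_nonneg_right hC (hS _))⟩,
      fun i => ⟨(hf.2 i).1, ih (hf.2 i).2⟩⟩

theorem HBound.of_succ {f : G → F} (hf : 𝒢.HBound X S (k + 1) a C f) : 𝒢.HBound X S k a C f := by
  induction k generalizing a f with
  | zero => exact hf.1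
  | succ k ih => exact ⟨hf.1, fun i => ⟨(hf.2 i).1, ih (hf.2 i).2⟩⟩

/-- `HBound` applies the innermost derivative first, whereas `wordDeriv` adds derivatives on the
outside; hence words are split at their last letter. -/
theorem hBound_iff {f : G → F} : 𝒢.HBound X S k a C f ↔ 𝒢.HorizontalContDiff X k f ∧
    ∀ w : List (Fin d), w.length ≤ k → ∀ p, ‖𝒢.wordDeriv X f w p‖ ≤ C * S (a + w.length) := by
  induction k generalizing a f with
  | zero =>
    constructor
    · intro h
      refine ⟨⟨fun w hw => ?_, fun w hw => by omega⟩, fun w hw p => ?_⟩ <;>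
        obtain rfl : w = [] := List.length_eq_zero_iff.1 (by omega)
      · exact h.1
      · exact h.2 p
    · intro h
      exact ⟨h.1.1 [] le_rfl, fun p => h.2 [] le_rfl p⟩
  | succ k ih =>
    constructor
    · rintro ⟨⟨h1, h2⟩, h3⟩
      have h4 := fun i => ih.1 (h3 i).2
      refine ⟨⟨fun w hw => ?_, fun w hw => ?_⟩, fun w hw => ?_⟩ <;>
        rcases List.eq_nil_or_concat' w with rfl | ⟨w, i, rfl⟩
      · exact h1
      · rw [wordDeriv_append_singleton]
        exact (h4 i).1.1 w (by simpa using hw)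
      · exact fun i => (h3 i).1
      · rw [wordDeriv_append_singleton]
        exact (h4 i).1.2 w (by simpa using hw)
      · exact h2
      · rw [wordDeriv_append_singleton]
        intro p
        refine ((h4 i).2 w (by simpa using hw) p).trans_eq ?_
        rw [List.length_append, List.length_singleton, add_assoc, add_comm 1]
    · rintro ⟨⟨h1, h2⟩, h3⟩
      refine ⟨⟨h1 [] (by simp), fun p => h3 [] (by simp) p⟩, fun i => ⟨h2 [] (by simp) i,
        ih.2 ⟨⟨fun w hw => ?_, fun w hw => ?_⟩, fun w hw p => ?_⟩⟩⟩
      · rw [← wordDeriv_append_singleton]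
        exact h1 _ (by simpa using hw)
      · rw [← wordDeriv_append_singleton]
        exact h2 _ (by simpa using hw)
      · rw [← wordDeriv_append_singleton]
        refine (h3 _ (by simpa using hw) p).trans_eq ?_
        rw [List.length_append, List.length_singleton, add_assoc, add_comm 1]

theorem HBound.add {f g : G → F} (hf : 𝒢.HBound X S k a C f) (hg : 𝒢.HBound X S k a C' g) :
    𝒢.HBound X S k a (C + C') (fun p => f p + g p) := by
  have h0 : Continuous (fun p => f p + g p) ∧ ∀ p, ‖f p + g p‖ ≤ (C + C') * S a :=
    ⟨hf.continuous.add hg.continuous, fun p => (norm_add_le _ _).trans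
      ((add_le_add (hf.norm_le p) (hg.norm_le p)).trans_eq (by ring))⟩
  induction k generalizing a f g with
  | zero => exact h0
  | succ k ih =>
    refine ⟨h0, fun i => ?_⟩
    have h1 := fun p => ((hf.2 i).1.hasDerivAt p).add ((hg.2 i).1.hasDerivAt p)
    refine ⟨fun p => (h1 p).differentiableAt, ?_⟩
    have e : 𝒢.hderiv X i (fun p => f p + g p) = fun p => 𝒢.hderiv X i f p + 𝒢.hderiv X i g p :=
      funext fun p => (h1 p).deriv
    rw [e]
    have hf' := (hf.2 i).2
    have hg' := (hg.2 i).2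
    exact ih hf' hg' ⟨hf'.continuous.add hg'.continuous, fun p => (norm_add_le _ _).trans
      ((add_le_add (hf'.norm_le p) (hg'.norm_le p)).trans_eq (by ring))⟩

theorem HBound.const_smul (c : ℝ) {f : G → F} (hf : 𝒢.HBound X S k a C f) :
    𝒢.HBound X S k a (|c| * C) (fun p => c • f p) := by
  induction k generalizing a f with
  | zero =>
    refine ⟨hf.1.const_smul c, fun p => ?_⟩
    rw [norm_smul, Real.norm_eq_abs, mul_assoc]
    exact mul_le_mul_of_nonneg_left (hf.2 p) (abs_nonneg c)
  | succ k ih =>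
    refine ⟨⟨hf.1.1.const_smul c, fun p => ?_⟩, fun i => ?_⟩
    · rw [norm_smul, Real.norm_eq_abs, mul_assoc]
      exact mul_le_mul_of_nonneg_left (hf.1.2 p) (abs_nonneg c)
    · have h1 := fun p => ((hf.2 i).1.hasDerivAt p).const_smul c
      refine ⟨fun p => (h1 p).differentiableAt, ?_⟩
      have e : 𝒢.hderiv X i (fun p => c • f p) = fun p => c • 𝒢.hderiv X i f p :=
        funext fun p => (h1 p).deriv
      rw [e]
      exact ih (hf.2 i).2

/-- The weights used in the bounds of horizontal derivatives. -/
structure IsWeight (S : ℕ → ℝ) (J : ℕ) : Prop where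
  nonneg : ∀ i, 0 ≤ S i
  zero : S 0 = 1
  mul_le : ∀ i i', i + i' ≤ J → S i * S i' ≤ S (i + i')

/-- Leibniz rule: each derivative doubles the number of terms, whence 2 ^ k, and the inequality S i
· S i' ≤ S (i + i') merges the weights of the two factors. -/
theorem HBound.bilin (hS : IsWeight S J) (B : F₁ →L[ℝ] F₂ →L[ℝ] F)
    (hB : ∀ u v, ‖B u v‖ ≤ ‖u‖ * ‖v‖) (hC : 0 ≤ C) (hC' : 0 ≤ C') {f : G → F₁} {g : G → F₂}
    (hf : 𝒢.HBound X S k a C f) (hg : 𝒢.HBound X S k b C' g) (hJ : a + b + k ≤ J) :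
    𝒢.HBound X S k (a + b) (2 ^ k * (C * C')) (fun p => B (f p) (g p)) := by
  induction k generalizing a b f g with
  | zero =>
    refine ⟨(B.continuous.comp hf.continuous).clm_apply hg.continuous, fun p => ?_⟩
    calc ‖B (f p) (g p)‖ ≤ ‖f p‖ * ‖g p‖ := hB _ _
      _ ≤ (C * S a) * (C' * S b) := mul_le_mul (hf.norm_le p) (hg.norm_le p) (norm_nonneg _)
          (mul_nonneg hC (hS.nonneg _))
      _ = (C * C') * (S a * S b) := by ring
      _ ≤ (C * C') * S (a + b) :=
          mul_le_mul_of_nonneg_left (hS.mul_le _ _ hJ) (mul_nonneg hC hC')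
      _ = 2 ^ 0 * (C * C') * S (a + b) := by rw [pow_zero, one_mul]
  | succ k ih =>
    refine ⟨⟨(B.continuous.comp hf.continuous).clm_apply hg.continuous, fun p => ?_⟩, fun i => ?_⟩
    · refine ((ih hf.of_succ hg.of_succ (by omega)).norm_le p).trans ?_
      refine mul_le_mul_of_nonneg_right (mul_le_mul_of_nonneg_right ?_ (mul_nonneg hC hC'))
        (hS.nonneg _)
      exact pow_le_pow_right₀ one_le_two (by omega)
    · have h1 : ∀ p, HasDerivAt (fun t : ℝ => B (f (p * t • 𝒢.horizontal X i))
          (g (p * t • 𝒢.horizontal X i)))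
          (B (𝒢.hderiv X i f p) (g p) + B (f p) (𝒢.hderiv X i g p)) 0 := fun p => by
        have := (B.hasFDerivAt.comp_hasDerivAt 0 ((hf.2 i).1.hasDerivAt p)).clm_apply
          ((hg.2 i).1.hasDerivAt p)
        simpa only [Function.comp_def, 𝒢.mul_zero_smul] using this
      refine ⟨fun p => (h1 p).differentiableAt, ?_⟩
      have e : 𝒢.hderiv X i (fun p => B (f p) (g p)) =
          fun p => B (𝒢.hderiv X i f p) (g p) + B (f p) (𝒢.hderiv X i g p) :=
        funext fun p => (h1 p).deriv
      rw [e]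
      have h2 := ih (hf.2 i).2 hg.of_succ (by omega)
      have h3 := ih hf.of_succ (hg.2 i).2 (by omega)
      rw [show a + 1 + b = a + b + 1 by omega] at h2
      rw [← add_assoc] at h3
      convert! h2.add h3 using 1
      ring

theorem HBound.mul (hS : IsWeight S J) (hC : 0 ≤ C) (hC' : 0 ≤ C') {f g : G → ℝ}
    (hf : 𝒢.HBound X S k a C f) (hg : 𝒢.HBound X S k b C' g) (hJ : a + b + k ≤ J) :
    𝒢.HBound X S k (a + b) (2 ^ k * (C * C')) (fun p => f p * g p) :=
  hf.bilin hS (ContinuousLinearMap.mul ℝ ℝ) (fun u v => by simp) hC hC' hg hJ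

theorem HBound.smul (hS : IsWeight S J) (hC : 0 ≤ C) (hC' : 0 ≤ C') {f : G → ℝ} {g : G → F}
    (hf : 𝒢.HBound X S k a C f) (hg : 𝒢.HBound X S k b C' g) (hJ : a + b + k ≤ J) :
    𝒢.HBound X S k (a + b) (2 ^ k * (C * C')) (fun p => f p • g p) :=
  hf.bilin hS (ContinuousLinearMap.lsmul ℝ ℝ) (fun u v => by simp [norm_smul]) hC hC' hg hJ

theorem HBound.inner {H : Type*} [NormedAddCommGroup H] [InnerProductSpace ℝ H]
    (hS : IsWeight S J) (hC : 0 ≤ C) (hC' : 0 ≤ C') {f g : G → H}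
    (hf : 𝒢.HBound X S k a C f) (hg : 𝒢.HBound X S k b C' g) (hJ : a + b + k ≤ J) :
    𝒢.HBound X S k (a + b) (2 ^ k * (C * C')) (fun p => inner ℝ (f p) (g p)) :=
  hf.bilin hS (innerSL ℝ) (fun u v => norm_inner_le_norm u v) hC hC' hg hJ

variable (𝒢 X) in
/-- The function `f ^ (-1/2)` is controlled by `f` and a lower bound of `f`. -/
theorem exists_hBound_inv_sqrt (k : ℕ) {c C : ℝ} (hc : 0 < c) (hC : 0 ≤ C) :
    ∃ K : ℝ, 0 ≤ K ∧ ∀ (S : ℕ → ℝ) (J : ℕ), IsWeight S J → k ≤ J → ∀ f : G → ℝ,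
      𝒢.HBound X S k 0 C f → (∀ p, c ≤ f p) →
      𝒢.HBound X S k 0 K (fun p => (√(f p))⁻¹) := by
  induction k with
  | zero =>
    refine ⟨(√c)⁻¹, by positivity, fun S J hS _ f hf hcf => ⟨?_, fun p => ?_⟩⟩
    · exact (Real.continuous_sqrt.comp hf.continuous).inv₀ fun p =>
        (Real.sqrt_pos.2 (hc.trans_le (hcf p))).ne'
    · rw [hS.zero, mul_one, Real.norm_of_nonneg (by positivity)]
      exact inv_anti₀ (Real.sqrt_pos.2 hc) (Real.sqrt_le_sqrt (hcf p))
  | succ k ih =>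
    obtain ⟨K, hK, h⟩ := ih
    refine ⟨max K (|(-(1 / 2) : ℝ)| * (2 ^ k * (2 ^ k * (2 ^ k * (K * K) * K) * C))), le_max_of_le_left hK,
      fun S J hS hJ f hf hcf => ⟨?_, fun i => ?_⟩⟩
    · have h1 := (h S J hS (by omega) f hf.of_succ hcf).mono hS.nonneg (le_max_left K
        (|(-(1 / 2) : ℝ)| * (2 ^ k * (2 ^ k * (2 ^ k * (K * K) * K) * C))))
      exact ⟨h1.continuous, h1.norm_le⟩
    · have h0 := h S J hS (by omega) f hf.of_succ hcf
      have hpos : ∀ p, 0 < f p := fun p => hc.trans_le (hcf p)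
      -- The derivative −(1/2) (f^(−1/2))³ · X f involves only f^(−1/2) itself and X f, so the bound
      -- of order k for f^(−1/2) gives the one of order k + 1.
      have h1 : ∀ p, HasDerivAt (fun t : ℝ => (√(f (p * t • 𝒢.horizontal X i)))⁻¹)
          ((-(1 / 2) : ℝ) • ((√(f p))⁻¹ * (√(f p))⁻¹ * (√(f p))⁻¹ * 𝒢.hderiv X i f p)) 0 := fun p => by
        have h2 := (hf.2 i).1.hasDerivAt p
        have h3 := (h2.sqrt (by rw [𝒢.mul_zero_smul]; exact (hpos p).ne')).fun_inv
          (by rw [𝒢.mul_zero_smul]; exact (Real.sqrt_pos.2 (hpos p)).ne')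
        refine h3.congr_deriv ?_
        rw [𝒢.mul_zero_smul]
        have := (Real.sqrt_pos.2 (hpos p)).ne'
        simp only [smul_eq_mul]
        field_simp
      refine ⟨fun p => (h1 p).differentiableAt, ?_⟩
      have e : 𝒢.hderiv X i (fun p => (√(f p))⁻¹) = fun p => (-(1 / 2) : ℝ) •
          ((√(f p))⁻¹ * (√(f p))⁻¹ * (√(f p))⁻¹ * 𝒢.hderiv X i f p) :=
        funext fun p => (h1 p).deriv
      rw [e]
      have h4 := h0.mul hS hK hK h0 (by omega)
      have h5 := h4.mul hS (by positivity) hK h0 (by omega)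
      have h6 := (h5.mul hS (by positivity) hC (hf.2 i).2 (by omega)).const_smul (-(1 / 2) : ℝ)
      simp only [zero_add] at h6 ⊢
      exact h6.mono hS.nonneg (le_max_right _ _)

theorem hBound_const (hS : IsWeight S J) (c : F) : 𝒢.HBound X S k 0 ‖c‖ (fun _ => c) := by
  have h0 : ∀ (k a : ℕ), 𝒢.HBound X S k a 0 (fun _ => (0 : F)) := by
    intro k
    induction k with
    | zero => exact fun a => ⟨continuous_const, by simp⟩
    | succ k ih =>
      refine fun a => ⟨⟨continuous_const, by simp⟩, fun i => ⟨fun p => by simp, ?_⟩⟩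
      have e : 𝒢.hderiv X i (fun _ => (0 : F)) = fun _ => 0 := by ext; simp [hderiv]
      rw [e]; exact ih _
  have h1 : Continuous (fun _ : G => c) ∧ ∀ _ : G, ‖c‖ ≤ ‖c‖ * S 0 :=
    ⟨continuous_const, by simp [hS.zero]⟩
  cases k with
  | zero => exact h1
  | succ k =>
    refine ⟨h1, fun i => ⟨fun p => by simp, ?_⟩⟩
    have e : 𝒢.hderiv X i (fun _ => c) = fun _ => 0 := by ext; simp [hderiv]
    rw [e]; exact (h0 _ _).mono hS.nonneg (norm_nonneg c)

theorem HBound.sum {ι : Type*} (T : Finset ι) {C : ℝ} {f : ι → G → F} (hS : IsWeight S J)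
    (hf : ∀ i ∈ T, 𝒢.HBound X S k 0 C (f i)) :
    𝒢.HBound X S k 0 (T.card * C) (fun p => ∑ i ∈ T, f i p) := by
  classical
  induction T using Finset.induction_on with
  | empty => simpa using hBound_const (𝒢 := 𝒢) (X := X) (k := k) hS (0 : F)
  | insert i T hi ih =>
    simp only [Finset.sum_insert hi, Finset.card_insert_of_notMem hi]
    have h := (hf i (by simp)).add (ih fun j hj => hf j (by simp [hj]))
    convert! h using 1
    push_cast; ring

end HorizontalCalculus

end CarnotGroup

namespace CarnotGroup

/-! ### Smooth functions, translations, dilations and the mean value inequality -/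

section SmoothFunctions

variable {G : Type*} [NormedAddCommGroup G] [NormedSpace ℝ G] [FiniteDimensional ℝ G] [Group G]
  [LieGroup 𝓘(ℝ, G) ∞ G] (𝒢 : CarnotGroup G) {d : ℕ}
  (X : Module.Basis (Fin d) ℝ (𝒢.layer 1))
  {F : Type*} [NormedAddCommGroup F] [NormedSpace ℝ F]

theorem hasDerivAt_of_contDiff {f : G → F} (hf : ContDiff ℝ ∞ f) (i : Fin d) (p : G) :
    HasDerivAt (fun t : ℝ => f (p * t • 𝒢.horizontal X i))
      (fderiv ℝ f p (leftFrame p (𝒢.horizontal X i))) 0 := by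
  have h1 := hasDerivAt_mul_smul' 𝒢.smul_mul_smul p 0 (𝒢.horizontal X i)
  have h2 := (hf.differentiable (by simp) (p * (0 : ℝ) • 𝒢.horizontal X i)).hasFDerivAt
  have h3 := h2.comp_hasDerivAt 0 h1
  rwa [𝒢.mul_zero_smul] at h3

theorem contDiff_hderiv {f : G → F} (hf : ContDiff ℝ ∞ f) (i : Fin d) :
    ContDiff ℝ ∞ (𝒢.hderiv X i f) := by
  have e : 𝒢.hderiv X i f = fun p => fderiv ℝ f p (leftFrame p (𝒢.horizontal X i)) :=
    funext fun p => (𝒢.hasDerivAt_of_contDiff X hf i p).deriv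
  rw [e]
  exact (hf.fderiv_right (m := ∞) (by simp)).clm_apply
    (contDiff_leftFrame.clm_apply contDiff_const)

theorem contDiff_wordDeriv {f : G → F} (hf : ContDiff ℝ ∞ f) (w : List (Fin d)) :
    ContDiff ℝ ∞ (𝒢.wordDeriv X f w) := by
  induction w with
  | nil => exact hf
  | cons i w ih => rw [wordDeriv_cons]; exact 𝒢.contDiff_hderiv X ih i

theorem horizontalContDiff_of_contDiff {f : G → F} (hf : ContDiff ℝ ∞ f) (j : ℕ) :
    𝒢.HorizontalContDiff X j f :=
  ⟨fun w _ => (𝒢.contDiff_wordDeriv X hf w).continuous, fun w _ i p =>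
    (𝒢.hasDerivAt_of_contDiff X (𝒢.contDiff_wordDeriv X hf w) i p).differentiableAt⟩

theorem hderiv_congr {f g : G → F} {p : G} (h : f =ᶠ[𝓝 p] g) (i : Fin d) :
    𝒢.hderiv X i f =ᶠ[𝓝 p] 𝒢.hderiv X i g := by
  filter_upwards [h.eventually_nhds] with q hq
  refine Filter.EventuallyEq.deriv_eq ?_
  have hc : ContinuousAt (fun t : ℝ => q * t • 𝒢.horizontal X i) 0 :=
    (hasDerivAt_mul_smul q _ 0).continuousAt
  have ht : Filter.Tendsto (fun t : ℝ => q * t • 𝒢.horizontal X i) (𝓝 0) (𝓝 q) := by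
    have := hc.tendsto
    rwa [𝒢.mul_zero_smul] at this
  exact ht.eventually hq

theorem wordDeriv_congr {f g : G → F} {p : G} (h : f =ᶠ[𝓝 p] g) (w : List (Fin d)) :
    𝒢.wordDeriv X f w =ᶠ[𝓝 p] 𝒢.wordDeriv X g w := by
  induction w with
  | nil => exact h
  | cons i w ih => rw [wordDeriv_cons, wordDeriv_cons]; exact 𝒢.hderiv_congr X ih i

theorem wordDeriv_zero (w : List (Fin d)) : 𝒢.wordDeriv X (fun _ : G => (0 : F)) w = fun _ => 0 := by
  induction w with
  | nil => rfl
  | cons i w ih => rw [wordDeriv_cons, ih]; ext; simp [hderiv]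

theorem hasCompactSupport_wordDeriv {f : G → F} (hf : HasCompactSupport f) (w : List (Fin d)) :
    HasCompactSupport (𝒢.wordDeriv X f w) := by
  refine HasCompactSupport.intro' hf (isClosed_tsupport f) fun p hp => ?_
  have h := (𝒢.wordDeriv_congr X (notMem_tsupport_iff_eventuallyEq.1 hp) w).self_of_nhds
  rw [h]
  exact congrFun (𝒢.wordDeriv_zero X w) p

theorem isWeight_one (J : ℕ) : IsWeight (fun _ => 1) J := ⟨by simp, rfl, by simp⟩

/-- Every horizontal derivative is continuous with compact support, and there are finitely many
words of length at most `j`. -/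
theorem exists_hBound_of_hasCompactSupport {f : G → F} (hf : ContDiff ℝ ∞ f)
    (hc : HasCompactSupport f) (j : ℕ) :
    ∃ M, 0 ≤ M ∧ 𝒢.HBound X (fun _ => 1) j 0 M f := by
  have h1 : ∀ w : List (Fin d), ∃ C, ∀ p, ‖𝒢.wordDeriv X f w p‖ ≤ C := fun w =>
    (𝒢.contDiff_wordDeriv X hf w).continuous.bounded_above_of_compact_support
      (𝒢.hasCompactSupport_wordDeriv X hc w)
  choose C hC using h1
  obtain ⟨M, hM⟩ := ((List.finite_length_le (Fin d) j).image C).bddAbove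
  refine ⟨max M 0, le_max_right _ _, hBound_iff.2 ⟨𝒢.horizontalContDiff_of_contDiff X hf j,
    fun w hw p => ?_⟩⟩
  rw [mul_one]
  exact (hC w p).trans ((hM ⟨w, hw, rfl⟩).trans (le_max_left _ _))

variable {𝒢 X} in
theorem HBound.comp_mul_left {S : ℕ → ℝ} {k a : ℕ} {C : ℝ} {f : G → F}
    (hf : 𝒢.HBound X S k a C f) (g : G) : 𝒢.HBound X S k a C (fun p => f (g * p)) := by
  have hg : Continuous (fun p : G => g * p) :=
    continuous_iff_continuousAt.2 fun p => (hasFDerivAt_mul_left g p).continuousAt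
  induction k generalizing a f with
  | zero => exact ⟨hf.1.comp hg, fun p => hf.2 _⟩
  | succ k ih =>
    refine ⟨⟨hf.1.1.comp hg, fun p => hf.1.2 _⟩, fun i => ⟨fun p => ?_, ?_⟩⟩
    · simpa only [mul_assoc] using (hf.2 i).1 (g * p)
    · have e : 𝒢.hderiv X i (fun p => f (g * p)) = fun p => 𝒢.hderiv X i f (g * p) := by
        ext p; simp only [hderiv, mul_assoc]
      rw [e]
      exact ih (hf.2 i).2

variable {𝒢 X} in
-- Horizontal fields are homogeneous of degree 1: X(f ∘ δ_s) = s · (X f) ∘ δ_s. The factor s ^ a in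
-- the function keeps the induction on the order going.
theorem HBound.comp_dil {k a : ℕ} {C s : ℝ} (hs : 0 ≤ s) {f : G → F}
    (hf : 𝒢.HBound X (fun _ => 1) k a C f) :
    𝒢.HBound X (fun l => s ^ l) k a C (fun p => s ^ a • f (𝒢.dil s p)) := by
  have h0 : ∀ (a : ℕ) (f : G → F), Continuous f → (∀ p, ‖f p‖ ≤ C * 1) →
      Continuous (fun p => s ^ a • f (𝒢.dil s p)) ∧
        ∀ p, ‖s ^ a • f (𝒢.dil s p)‖ ≤ C * s ^ a := by
    intro a f h1 h2
    refine ⟨(h1.comp (𝒢.dil s).continuous).const_smul _, fun p => ?_⟩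
    rw [norm_smul, Real.norm_of_nonneg (by positivity), mul_comm C]
    exact mul_le_mul_of_nonneg_left (by simpa using h2 (𝒢.dil s p)) (by positivity)
  induction k generalizing a f with
  | zero => exact h0 a f hf.1 hf.2
  | succ k ih =>
    have hd : ∀ i p, HasDerivAt (fun t : ℝ => s ^ a • f (𝒢.dil s (p * t • 𝒢.horizontal X i)))
        (s ^ (a + 1) • 𝒢.hderiv X i f (𝒢.dil s p)) 0 := by
      intro i p
      have h1 := (hf.2 i).1.hasDerivAt (𝒢.dil s p)
      have h2 : HasDerivAt (fun t : ℝ => t * s) s 0 := by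
        simpa using (hasDerivAt_id (0 : ℝ)).mul_const s
      rw [← zero_mul s] at h1
      have h3 := (h1.scomp 0 h2).const_smul (s ^ a)
      simp only [dil_mul, map_smul, dil_horizontal, smul_smul]
      rw [pow_succ, mul_smul]
      exact h3
    refine ⟨h0 a f hf.1.1 hf.1.2, fun i => ⟨fun p => (hd i p).differentiableAt, ?_⟩⟩
    have e : 𝒢.hderiv X i (fun p => s ^ a • f (𝒢.dil s p)) =
        fun p => s ^ (a + 1) • 𝒢.hderiv X i f (𝒢.dil s p) := funext fun p => (hd i p).deriv
    rw [e]
    exact ih (hf.2 i).2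

variable {𝒢 X} in
-- The mean value inequality along each letter of the word, summed up.
theorem norm_sub_le_of_mem_ccBall {f : G → F} {L r : ℝ} (hL : 0 ≤ L)
    (hf : ∀ i, 𝒢.HDifferentiable X i f) (hfL : ∀ i p, ‖𝒢.hderiv X i f p‖ ≤ L) (p : G) {g : G}
    (hg : g ∈ ccBall (𝒢.horizontal X) r) : ‖f (p * g) - f p‖ ≤ L * r := by
  obtain ⟨l, hl, rfl⟩ := hg
  refine le_trans ?_ (mul_le_mul_of_nonneg_left hl hL)
  clear hl
  induction l generalizing p with
  | nil => simp
  | cons a l ih =>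
    simp only [List.map_cons, List.prod_cons, List.sum_cons]
    have h1 := ih (p * a.2 • 𝒢.horizontal X a.1)
    have h2 := convex_univ.norm_image_sub_le_of_norm_hasDerivWithin_le
      (f := fun t : ℝ => f (p * t • 𝒢.horizontal X a.1)) (x := 0) (y := a.2)
      (fun t _ => ((hf a.1).hasDerivAt' p t).hasDerivWithinAt) (fun t _ => hfL _ _)
      (Set.mem_univ _) (Set.mem_univ _)
    rw [𝒢.mul_zero_smul, sub_zero, Real.norm_eq_abs] at h2
    rw [mul_assoc] at h1
    have h3 := norm_add_le (f (p * (a.2 • 𝒢.horizontal X a.1 *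
      (l.map fun a => a.2 • 𝒢.horizontal X a.1).prod)) - f (p * a.2 • 𝒢.horizontal X a.1))
      (f (p * a.2 • 𝒢.horizontal X a.1) - f p)
    rw [sub_add_sub_cancel] at h3
    linarith

end SmoothFunctions

/-! ### Separated nets and bump functions -/

section Nets

variable {G : Type*} [NormedAddCommGroup G] [NormedSpace ℝ G] [FiniteDimensional ℝ G] [Group G]
  [LieGroup 𝓘(ℝ, G) ∞ G] (𝒢 : CarnotGroup G) {d : ℕ}
  (X : Module.Basis (Fin d) ℝ (𝒢.layer 1))

theorem _root_.Set.finite_and_ncard_le_of_forall_card_le {α : Type*} {s : Set α} {c : ℝ}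
    (h : ∀ T : Finset α, ↑T ⊆ s → (T.card : ℝ) ≤ c) : s.Finite ∧ (s.ncard : ℝ) ≤ c := by
  have hf : s.Finite := by
    by_contra hs
    obtain ⟨T, hT, hc⟩ := Set.Infinite.exists_subset_card_eq hs (⌊c⌋₊ + 1)
    have := h T hT
    rw [hc] at this
    push_cast at this
    exact absurd (Nat.lt_floor_add_one c) (not_lt.2 this)
  refine ⟨hf, ?_⟩
  rw [Set.ncard_eq_toFinset_card s hf]
  exact h _ (by simp)

/-- Take a maximal set whose translates of the open unit ball are disjoint. A point whose translate
meets that of `g` is at distance at most 1 + 1 from `g`, so maximality gives the covering;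
disjointness gives the count. -/
theorem exists_net : ∃ N : Set G, N.Countable ∧
    (∀ q, ∃ g ∈ N, g⁻¹ * q ∈ ccBall (𝒢.horizontal X) 2) ∧
    ∀ r, 0 ≤ r → ∀ q, {g ∈ N | q⁻¹ * g ∈ ccBall (𝒢.horizontal X) r}.Finite ∧
      ({g ∈ N | q⁻¹ * g ∈ ccBall (𝒢.horizontal X) r}.ncard : ℝ) ≤
        2 * (r + 2) ^ 𝒢.hausdorffDim := by
  have := topologicalGroup_of_lieGroup 𝓘(ℝ, G) ∞ (G := G)
  set B := interior (ccBall (𝒢.horizontal X) 1) with hB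
  have h1B : (1 : G) ∈ B := mem_interior_iff_mem_nhds.2 (𝒢.ccBall_mem_nhds X one_pos)
  obtain ⟨N, hN⟩ := zorn_subset {N : Set G | N.PairwiseDisjoint fun g => (g * ·) '' B} (by
    intro c hc hchain
    refine ⟨⋃₀ c, ?_, fun s hs => Set.subset_sUnion_of_mem hs⟩
    exact (Set.pairwiseDisjoint_sUnion hchain.directedOn).2 fun a ha => hc ha)
  have hNd : N.PairwiseDisjoint fun g => (g * ·) '' B := hN.prop
  refine ⟨N, hNd.countable_of_isOpen
    (fun g _ => (Homeomorph.mulLeft g).isOpenMap _ isOpen_interior) (fun g _ => ⟨_, 1, h1B, rfl⟩),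
    fun q => ?_, fun r hr q => Set.finite_and_ncard_le_of_forall_card_le fun T hT => ?_⟩
  · by_cases hq : q ∈ N
    · exact ⟨q, hq, by rw [inv_mul_cancel]; exact one_mem_ccBall (by norm_num)⟩
    by_contra! hcon
    refine hq (hN.le_of_ge (y := insert q N) ?_ (Set.subset_insert q N) (Set.mem_insert q N))
    refine hNd.insert fun g hg _ => ?_
    rw [Set.disjoint_left]
    rintro _ ⟨b, hb, rfl⟩ ⟨c, hc, hbc⟩
    refine hcon g hg ?_
    have e : g⁻¹ * q = c * b⁻¹ := by
      have hbc : g * c = q * b := hbc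
      rw [eq_mul_inv_iff_mul_eq, mul_assoc, ← hbc, inv_mul_cancel_left]
    rw [e, ← one_add_one_eq_two]
    exact mul_mem_ccBall (interior_subset hc)
      (inv_mem_ccBall 𝒢.smul_mul_smul (interior_subset hb))
  · exact 𝒢.card_le_of_pairwiseDisjoint X hr q T (fun g hg => (hT hg).2)
      (hNd.subset fun g hg => (hT hg).1)

/-- Smooth Urysohn separation: the closure of the ball of radius 2 lies in the ball of radius 3,
hence in the interior of that of radius 4. -/
theorem exists_bump : ∃ φ : G → ℝ, ContDiff ℝ ∞ φ ∧ HasCompactSupport φ ∧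
    (∀ x ∈ ccBall (𝒢.horizontal X) 2, φ x = 1) ∧
    ∀ x, φ x ≠ 0 → x ∈ ccBall (𝒢.horizontal X) 4 := by
  obtain ⟨φ, h1, -, h2, h3⟩ := exists_contMDiff_zero_iff_one_iff_of_isClosed 𝓘(ℝ, G) (n := ⊤)
    (s := (interior (ccBall (𝒢.horizontal X) 4))ᶜ) (t := closure (ccBall (𝒢.horizontal X) 2))
    isOpen_interior.isClosed_compl isClosed_closure (by
      rw [Set.disjoint_compl_left_iff_subset]
      exact (𝒢.closure_ccBall_subset X (by norm_num : (2 : ℝ) < 3)).trans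
        (𝒢.ccBall_subset_interior X (by norm_num)))
  have h4 : ∀ x, φ x ≠ 0 → x ∈ ccBall (𝒢.horizontal X) 4 := fun x hx =>
    interior_subset (by simpa using mt (h2 x).1 hx)
  refine ⟨φ, contMDiff_iff_contDiff.1 h1, ?_, fun x hx => (h3 x).1 (subset_closure hx), h4⟩
  exact HasCompactSupport.intro' (K := closure (ccBall (𝒢.horizontal X) 4))
    (𝒢.isBounded_ccBall X 4).isCompact_closure isClosed_closure fun x hx => by
      by_contra h
      exact hx (subset_closure (h4 x h))

end Nets

/-! ### Greedy choice of orthogonal vectors -/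

section Greedy

variable {F : Type*} [NormedAddCommGroup F] [InnerProductSpace ℝ F] [FiniteDimensional ℝ F]

theorem exists_unit_orthogonal (s : Set F) (hs : s.Finite)
    (hc : s.ncard < Module.finrank ℝ F) : ∃ x : F, ‖x‖ = 1 ∧ ∀ y ∈ s, inner ℝ y x = 0 := by
  have hlt : Module.finrank ℝ (Submodule.span ℝ s) < Module.finrank ℝ F := by
    refine lt_of_le_of_lt ?_ hc
    have := hs.fintype
    rw [Set.ncard_eq_toFinset_card' s]
    exact finrank_span_le_card s
  have hne : (Submodule.span ℝ s)ᗮ ≠ ⊥ := fun h => by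
    rw [Submodule.orthogonal_eq_bot_iff] at h
    rw [h, finrank_top] at hlt
    exact lt_irrefl _ hlt
  obtain ⟨x, hx, hx0⟩ := Submodule.exists_mem_ne_zero_of_ne_bot hne
  refine ⟨(‖x‖⁻¹ : ℝ) • x, norm_smul_inv_norm hx0, fun y hy => ?_⟩
  rw [inner_smul_right, (Submodule.mem_orthogonal _ x).1 hx y (Submodule.subset_span hy), mul_zero]

/-- A greedy choice of unit vectors which are orthogonal to given vectors and to each other
whenever their indices are neighbors. -/
theorem exists_greedy_orthogonal {ι : Type*} [Countable ι] (nb : ι → ι → Prop)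
    (hsymm : ∀ α β, nb α β → nb β α) {M K : ℕ} (hnb : ∀ α, {β | nb α β}.Finite)
    (hK : ∀ α, {β | nb α β}.ncard ≤ K) (hMK : M + K < Module.finrank ℝ F) (V : ι → Fin M → F) :
    ∃ u : ι → F, (∀ α, ‖u α‖ = 1) ∧ (∀ α i, inner ℝ (V α i) (u α) = 0) ∧
      ∀ α β, α ≠ β → nb α β → inner ℝ (u α) (u β) = 0 := by
  obtain ⟨enc, henc⟩ := exists_injective_nat ι
  have h : ∀ (α : ι) (prev : ι → F), ∃ x : F, ‖x‖ = 1 ∧ (∀ i, inner ℝ (V α i) x = 0) ∧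
      ∀ β, nb α β → inner ℝ (prev β) x = 0 := by
    intro α prev
    have hf1 := Set.finite_range (V α)
    have hf2 := (hnb α).image prev
    obtain ⟨x, h1, h2⟩ := exists_unit_orthogonal (Set.range (V α) ∪ prev '' {β | nb α β})
      (hf1.union hf2) (by
        refine lt_of_le_of_lt ((Set.ncard_union_le _ _).trans (add_le_add ?_
          ((Set.ncard_image_le (hnb α)).trans (hK α)))) hMK
        rw [← Set.image_univ]
        refine (Set.ncard_image_le Set.finite_univ).trans ?_
        simp)
    exact ⟨x, h1, fun i => h2 _ (Or.inl ⟨i, rfl⟩), fun β hβ => h2 _ (Or.inr ⟨β, hβ, rfl⟩)⟩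
  choose pick h1 h2 h3 using h
  -- Recursion along an enumeration. Indices not yet treated, including `α` itself, contribute the
  -- vector 0, which imposes no condition.
  let u : ι → F := (measure enc).wf.fix fun α rec =>
    pick α fun β => if hβ : enc β < enc α then rec β hβ else 0
  have hu : ∀ α, u α = pick α fun β => if enc β < enc α then u β else 0 := fun α => by
    have := (measure enc).wf.fix_eq (fun α rec =>
      pick α fun β => if hβ : enc β < enc α then rec β hβ else 0) α
    simpa only [dite_eq_ite] using this
  have key : ∀ α β, enc β < enc α → nb α β → inner ℝ (u β) (u α) = 0 := fun α β hlt hnb => by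
    have := h3 α (fun β => if enc β < enc α then u β else 0) β hnb
    rwa [if_pos hlt, ← hu] at this
  refine ⟨u, fun α => by rw [hu]; exact h1 _ _, fun α i => by rw [hu]; exact h2 _ _ _,
    fun α β hne hnb => ?_⟩
  rcases lt_trichotomy (enc α) (enc β) with hlt | heq | hlt
  · exact key β α hlt (hsymm _ _ hnb)
  · exact absurd (henc heq) hne
  · rw [real_inner_comm]; exact key α β hlt hnb

end Greedy

end CarnotGroup

namespace CarnotGroup

/-! ### The almost orthogonal field at unit scale -/

section UnitScale

variable {G : Type*} [NormedAddCommGroup G] [NormedSpace ℝ G] [FiniteDimensional ℝ G] [Group G]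
  [LieGroup 𝓘(ℝ, G) ∞ G] (𝒢 : CarnotGroup G) {d : ℕ}
  (X : Module.Basis (Fin d) ℝ (𝒢.layer 1))

/-- The left side is the packing bound 2 (r + 2)^n for r = 8; the right side is what the dimension
hypothesis provides. -/
theorem two_mul_ten_pow_lt {n : ℕ} (hn : 1 ≤ n) : 2 * 10 ^ n < 2 ^ (4 * n + 7) * n := by
  have h1 : 10 ^ n ≤ 16 ^ n := Nat.pow_le_pow_left (by norm_num) n
  have h2 : 2 ^ (4 * n + 7) = 128 * 16 ^ n := by
    rw [pow_add, pow_mul]; norm_num; ring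
  have h3 : 0 < 16 ^ n := by positivity
  rw [h2]
  nlinarith

/-- A smooth vector field `U`, bounded from below, which is locally a combination of a bounded
number of vectors that are orthogonal to each other and to prescribed vectors `V g i` attached to
nearby points `g`. -/
theorem exists_field_almost_orthogonal [Nontrivial G] (j : ℕ) :
    ∃ A Q : ℝ, 0 ≤ A ∧ 0 ≤ Q ∧ ∀ D M : ℕ,
      M + 2 ^ (4 * 𝒢.hausdorffDim + 7) * 𝒢.hausdorffDim ≤ D →
      ∀ V : G → Fin M → EuclideanSpace ℝ (Fin D), ∃ U : G → EuclideanSpace ℝ (Fin D),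
        ContDiff ℝ ∞ U ∧ 𝒢.HBound X (fun _ => 1) j 0 A U ∧ (∀ q, 1 ≤ inner ℝ (U q) (U q)) ∧
        ∀ (q : G) (x : EuclideanSpace ℝ (Fin D)) (i : Fin M) (t : ℝ), 0 ≤ t →
          (∀ g, g⁻¹ * q ∈ ccBall (𝒢.horizontal X) 4 → ‖x - V g i‖ ≤ t) →
          |inner ℝ x (U q)| ≤ Q * t := by
  obtain ⟨N, hNc, hNcov, hNcard⟩ := 𝒢.exists_net X
  obtain ⟨φ, hφ, hφc, hφ1, hφ4⟩ := 𝒢.exists_bump X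
  obtain ⟨B, hB0, hB⟩ := 𝒢.exists_hBound_of_hasCompactSupport X hφ hφc j
  set n := 𝒢.hausdorffDim with hn
  have : Countable N := hNc.to_subtype
  have htg := topologicalGroup_of_lieGroup 𝓘(ℝ, G) ∞ (G := G)
  have hfin : ∀ r, 0 ≤ r → ∀ q : G, {g : N | q⁻¹ * g ∈ ccBall (𝒢.horizontal X) r}.Finite ∧
      ({g : N | q⁻¹ * g ∈ ccBall (𝒢.horizontal X) r}.ncard : ℝ) ≤ 2 * (r + 2) ^ n := by
    intro r hr q
    obtain ⟨h1, h2⟩ := hNcard r hr q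
    have e : ((↑) : N → G) '' {g : N | q⁻¹ * g ∈ ccBall (𝒢.horizontal X) r} =
        {g ∈ N | q⁻¹ * g ∈ ccBall (𝒢.horizontal X) r} := by
      ext g
      constructor
      · rintro ⟨g, hg, rfl⟩; exact ⟨g.2, hg⟩
      · rintro ⟨hg, hgr⟩; exact ⟨⟨g, hg⟩, hgr, rfl⟩
    rw [← e] at h1 h2
    exact ⟨h1.of_finite_image Subtype.val_injective.injOn, by
      rwa [Set.ncard_image_of_injective _ Subtype.val_injective] at h2⟩
  -- Radius 5 = 1 + 4: these net points include all those whose bump is nonzero somewhere on the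
  -- unit ball around `q`, so near `q` the field is one fixed finite sum.
  let T : G → Finset N := fun q => (hfin 5 (by norm_num) q).1.toFinset
  have hTcard : ∀ q, ((T q).card : ℝ) ≤ 2 * 7 ^ n := fun q => by
    have h := (hfin 5 (by norm_num) q).2
    rw [Set.ncard_eq_toFinset_card _ (hfin 5 (by norm_num) q).1] at h
    refine h.trans_eq (by norm_num)
  have hT : ∀ q q' : G, q⁻¹ * q' ∈ ccBall (𝒢.horizontal X) 1 → ∀ g : N, φ ((g : G)⁻¹ * q') ≠ 0 →
      g ∈ T q := by
    intro q q' hq g hg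
    have h1 := mul_mem_ccBall hq (inv_mem_ccBall 𝒢.smul_mul_smul (hφ4 _ hg))
    have e : q⁻¹ * q' * ((g : G)⁻¹ * q')⁻¹ = q⁻¹ * g := by group
    rw [e] at h1
    simp only [T, Set.Finite.mem_toFinset, Set.mem_ofPred_eq]
    exact ccBall_mono (by norm_num) h1
  have hTself : ∀ (q : G) (g : N), φ ((g : G)⁻¹ * q) ≠ 0 → g ∈ T q := fun q =>
    hT q q (by rw [inv_mul_cancel]; exact one_mem_ccBall zero_le_one)
  have hφB : ∀ x, |φ x| ≤ B := fun x => by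
    simpa using hB.norm_le x
  refine ⟨2 * 7 ^ n * (2 ^ j * (B * 1)), 2 * 7 ^ n * B, by positivity, by positivity,
    fun D M hD V => ?_⟩
  -- Neighbors are net points at distance at most 8 = 4 + 4, which covers every pair with
  -- overlapping bumps.
  obtain ⟨u, hu1, huV, huu⟩ := exists_greedy_orthogonal (F := EuclideanSpace ℝ (Fin D))
    (ι := N) (M := M) (K := 2 * 10 ^ n)
    (fun α β => (α : G)⁻¹ * β ∈ ccBall (𝒢.horizontal X) 8)
    (fun α β h => by
      have := inv_mem_ccBall 𝒢.smul_mul_smul h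
      rwa [mul_inv_rev, inv_inv] at this)
    (fun α => (hfin 8 (by norm_num) α).1)
    (fun α => by
      have := (hfin 8 (by norm_num) α).2
      norm_num at this
      exact_mod_cast this)
    (by
      rw [finrank_euclideanSpace_fin]
      have := two_mul_ten_pow_lt (n := n) 𝒢.one_le_hausdorffDim
      omega)
    (fun α => V α)
  let U : G → EuclideanSpace ℝ (Fin D) := fun q => ∑ᶠ g : N, φ ((g : G)⁻¹ * q) • u g
  have hUT : ∀ q q' : G, q⁻¹ * q' ∈ ccBall (𝒢.horizontal X) 1 →
      U q' = ∑ g ∈ T q, φ ((g : G)⁻¹ * q') • u g := fun q q' hq => by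
    refine finsum_eq_sum_of_support_subset _ fun g hg => ?_
    refine hT q q' hq g fun (h : φ ((g : G)⁻¹ * q') = 0) => hg ?_
    simp [h]
  have hUself : ∀ q, U q = ∑ g ∈ T q, φ ((g : G)⁻¹ * q) • u g := fun q =>
    hUT q q (by rw [inv_mul_cancel]; exact one_mem_ccBall zero_le_one)
  have hUloc : ∀ q, U =ᶠ[𝓝 q] fun q' => ∑ g ∈ T q, φ ((g : G)⁻¹ * q') • u g := fun q => by
    have hc : Continuous fun q' : G => q⁻¹ * q' := by fun_prop
    have ht := hc.tendsto q
    rw [inv_mul_cancel] at ht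
    filter_upwards [ht (𝒢.ccBall_mem_nhds X one_pos)] with q' hq'
    exact hUT q q' hq'
  have hφtr : ∀ g : G, ContDiff ℝ ∞ fun q => φ (g⁻¹ * q) := fun g =>
    hφ.comp (ContDiff.groupMul (n := ⊤) contDiff_const contDiff_id)
  have hU : ContDiff ℝ ∞ U := contDiff_iff_contDiffAt.2 fun q => by
    have h : ContDiff ℝ ∞ fun q' => ∑ g ∈ T q, φ ((g : G)⁻¹ * q') • u g :=
      ContDiff.sum fun g _ => (hφtr g).smul contDiff_const
    exact h.contDiffAt.congr_of_eventuallyEq (hUloc q)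
  refine ⟨U, hU, hBound_iff.2 ⟨𝒢.horizontalContDiff_of_contDiff X hU j, fun w hw q => ?_⟩,
    fun q => ?_, fun q x i t ht hx => ?_⟩
  · rw [(𝒢.wordDeriv_congr X (hUloc q) w).self_of_nhds]
    have h1 : ∀ g ∈ T q, 𝒢.HBound X (fun _ => 1) j 0 (2 ^ j * (B * 1))
        (fun q' => φ ((g : G)⁻¹ * q') • u g) := fun g _ => by
      have := (hB.comp_mul_left (g : G)⁻¹).smul (isWeight_one j) hB0 (norm_nonneg (u g))
        (hBound_const (isWeight_one j) (u g)) (by omega)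
      rwa [hu1, zero_add] at this
    have h2 := (HBound.sum (T q) (isWeight_one j) h1).mono (fun _ => zero_le_one)
      (mul_le_mul_of_nonneg_right (hTcard q) (by positivity))
    exact (hBound_iff.1 h2).2 w hw q
  -- All cross terms vanish: either one of the bumps is zero at `q`, or the two points are neighbors
  -- and their vectors are orthogonal.
  · have hdiag : inner ℝ (U q) (U q) = ∑ g ∈ T q, φ ((g : G)⁻¹ * q) ^ 2 := by
      rw [hUself, sum_inner]
      refine Finset.sum_congr rfl fun g hg => ?_
      rw [inner_sum, Finset.sum_eq_single g]
      · rw [inner_smul_left, inner_smul_right, real_inner_self_eq_norm_sq, hu1]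
        simp [sq]
      · intro g' _ hne
        rw [inner_smul_left, inner_smul_right]
        by_cases h1 : φ ((g : G)⁻¹ * q) = 0
        · simp [h1]
        by_cases h2 : φ ((g' : G)⁻¹ * q) = 0
        · simp [h2]
        have h3 := mul_mem_ccBall (hφ4 _ h1) (inv_mem_ccBall 𝒢.smul_mul_smul (hφ4 _ h2))
        have e : (g : G)⁻¹ * q * ((g' : G)⁻¹ * q)⁻¹ = (g : G)⁻¹ * g' := by group
        rw [e] at h3
        rw [huu g g' hne.symm (ccBall_mono (by norm_num) h3)]
        simp
      · exact fun h => absurd hg h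
    rw [hdiag]
    obtain ⟨g, hgN, hg⟩ := hNcov q
    have h1 := hφ1 _ hg
    have h2 : (⟨g, hgN⟩ : N) ∈ T q := hTself q ⟨g, hgN⟩ (by rw [h1]; exact one_ne_zero)
    refine le_trans (by rw [h1, one_pow]) (Finset.single_le_sum
      (f := fun g : N => φ ((g : G)⁻¹ * q) ^ 2) (fun g _ => sq_nonneg _) h2)
  · rw [hUself, inner_sum]
    calc |∑ g ∈ T q, inner ℝ x (φ ((g : G)⁻¹ * q) • u g)|
        ≤ ∑ g ∈ T q, |inner ℝ x (φ ((g : G)⁻¹ * q) • u g)| := Finset.abs_sum_le_sum_abs _ _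
      _ ≤ ∑ g ∈ T q, B * t := Finset.sum_le_sum fun g _ => ?_
      _ = (T q).card * (B * t) := by rw [Finset.sum_const, nsmul_eq_mul]
      _ ≤ 2 * 7 ^ n * (B * t) := mul_le_mul_of_nonneg_right (hTcard q) (by positivity)
      _ = 2 * 7 ^ n * B * t := by ring
    rw [inner_smul_right, abs_mul]
    by_cases h1 : φ ((g : G)⁻¹ * q) = 0
    · rw [h1, abs_zero, zero_mul]; positivity
    refine mul_le_mul (hφB _) ?_ (abs_nonneg _) hB0
    -- Only net points within distance 4 of `q` matter, and there `u g` is exactly orthogonal to `V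
    -- g i`.
    have e : inner ℝ x (u g) = inner ℝ (x - V g i) (u g) := by
      rw [inner_sub_left, huV, sub_zero]
    rw [e]
    refine (abs_real_inner_le_norm _ _).trans ?_
    rw [hu1, mul_one]
    exact hx g (hφ4 _ h1)

end UnitScale

end CarnotGroup

namespace CarnotGroup

/-! ### The weights 1 / R_l -/

section Weights

/-- The weights `1 / R l` for `1 ≤ l ≤ j`, completed by `1` for `l = 0`. -/
noncomputable def recipWeight (R : ℕ → ℝ) (j l : ℕ) : ℝ :=
  if l = 0 then 1 else if l ≤ j then (R l)⁻¹ else 0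

variable {R : ℕ → ℝ} {j : ℕ}

theorem recipWeight_of_mem {l : ℕ} (h1 : 1 ≤ l) (h2 : l ≤ j) : recipWeight R j l = (R l)⁻¹ := by
  rw [recipWeight, if_neg (by omega), if_pos h2]

theorem recipWeight_zero : recipWeight R j 0 = 1 := by simp [recipWeight]

theorem isWeight_recipWeight (hR : ∀ i, 1 ≤ i → i ≤ j → 0 < R i)
    (hmul : ∀ i i', 1 ≤ i → 1 ≤ i' → i + i' ≤ j → R (i + i') ≤ R i * R i') :
    IsWeight (recipWeight R j) j := by
  refine ⟨fun l => ?_, recipWeight_zero, fun i i' h => ?_⟩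
  · unfold recipWeight
    split_ifs with h1 h2
    · exact zero_le_one
    · exact inv_nonneg.2 (hR l (by omega) h2).le
    · exact le_rfl
  · rcases Nat.eq_zero_or_pos i with rfl | hi
    · rw [recipWeight_zero, one_mul, zero_add]
    rcases Nat.eq_zero_or_pos i' with rfl | hi'
    · rw [recipWeight_zero, mul_one, add_zero]
    rw [recipWeight_of_mem hi (by omega), recipWeight_of_mem hi' (by omega),
      recipWeight_of_mem (by omega) h, ← mul_inv]
    exact inv_anti₀ (hR _ (by omega) h) (hmul i i' hi hi' h)

theorem IsWeight.pow_le {S : ℕ → ℝ} {J : ℕ} (hS : IsWeight S J) {l : ℕ} (hl : l ≤ J) :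
    S 1 ^ l ≤ S l := by
  induction l with
  | zero => rw [pow_zero, hS.zero]
  | succ l ih =>
    rw [pow_succ]
    exact (mul_le_mul_of_nonneg_right (ih (by omega)) (hS.nonneg 1)).trans (hS.mul_le l 1 hl)

end Weights

/-! ### Passage between the weighted seminorm and `HBound` -/

section Seminorm

variable {G : Type*} [NormedAddCommGroup G] [NormedSpace ℝ G] [FiniteDimensional ℝ G] [Group G]
  [LieGroup 𝓘(ℝ, G) ∞ G] {𝒢 : CarnotGroup G} {d : ℕ}
  {X : Module.Basis (Fin d) ℝ (𝒢.layer 1)}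
  {F : Type*} [NormedAddCommGroup F] [NormedSpace ℝ F] {R : ℕ → ℝ} {j : ℕ} {f : G → F}

theorem norm_wordDeriv_le (hR : ∀ i, 1 ≤ i → i ≤ j → 0 < R i) {C : ℝ}
    (hC : 0 ≤ C) (hf : 𝒢.weightedSeminorm X j R f ≤ ENNReal.ofReal C) {w : List (Fin d)}
    (h1 : 1 ≤ w.length) (h2 : w.length ≤ j) (p : G) :
    ‖𝒢.wordDeriv X f w p‖ ≤ C * (R w.length)⁻¹ := by
  have h3 : ENNReal.ofReal (R w.length) * supNorm (𝒢.nabla X w.length f) ≤ ENNReal.ofReal C :=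
    (Finset.single_le_sum (f := fun k => ENNReal.ofReal (R k) * supNorm (𝒢.nabla X k f))
      (fun _ _ => zero_le) (Finset.mem_Icc.2 ⟨h1, h2⟩)).trans hf
  have h4 : ‖𝒢.nabla X w.length f p‖ₑ ≤ supNorm (𝒢.nabla X w.length f) :=
    le_iSup (fun p => ‖𝒢.nabla X w.length f p‖ₑ) p
  have h5 : ‖𝒢.wordDeriv X f w p‖ ≤ ‖𝒢.nabla X w.length f p‖ := by
    have := PiLp.norm_apply_le (𝒢.nabla X w.length f p) w.get
    simpa [nabla] using this
  have hRw := hR _ h1 h2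
  have h6 := (mul_le_mul_right h4 (ENNReal.ofReal (R w.length))).trans h3
  rw [← ofReal_norm, ← ENNReal.ofReal_mul hRw.le, ENNReal.ofReal_le_ofReal_iff hC] at h6
  rw [← div_eq_mul_inv, le_div_iff₀ hRw, mul_comm]
  exact (mul_le_mul_of_nonneg_left h5 hRw.le).trans h6

theorem hBound_of_weightedSeminorm_le (hR : ∀ i, 1 ≤ i → i ≤ j → 0 < R i)
    (hf : 𝒢.HorizontalContDiff X j f) (hf1 : ∀ p, ‖f p‖ = 1)
    (h : 𝒢.weightedSeminorm X j R f ≤ 1) : 𝒢.HBound X (recipWeight R j) j 0 1 f := by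
  refine hBound_iff.2 ⟨hf, fun w hw p => ?_⟩
  rw [zero_add]
  rcases Nat.eq_zero_or_pos w.length with h0 | h0
  · rw [h0, recipWeight_zero, one_mul]
    rw [List.length_eq_zero_iff.1 h0]
    exact (hf1 p).le
  · rw [recipWeight_of_mem h0 hw]
    exact norm_wordDeriv_le hR zero_le_one (by rwa [ENNReal.ofReal_one]) h0 hw p

/-- The gradient of order l has d ^ l components, each bounded by C / R l; the Euclidean norm costs
√(d ^ l), and the weights cancel. -/
theorem HBound.weightedSeminorm_le (hR : ∀ i, 1 ≤ i → i ≤ j → 0 < R i) {C : ℝ} (hC : 0 ≤ C)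
    (hf : 𝒢.HBound X (recipWeight R j) j 0 C f) :
    𝒢.weightedSeminorm X j R f ≤ ENNReal.ofReal (∑ l ∈ Finset.Icc 1 j, √(d ^ l) * C) := by
  rw [ENNReal.ofReal_sum_of_nonneg fun l _ => by positivity]
  refine Finset.sum_le_sum fun l hl => ?_
  obtain ⟨h1, h2⟩ := Finset.mem_Icc.1 hl
  have hRl := hR l h1 h2
  have h3 : supNorm (𝒢.nabla X l f) ≤ ENNReal.ofReal (√(d ^ l) * (C * (R l)⁻¹)) := by
    refine iSup_le fun p => ?_
    rw [← ofReal_norm]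
    refine ENNReal.ofReal_le_ofReal ?_
    have h4 : ∀ I : Fin l → Fin d, ‖𝒢.wordDeriv X f (List.ofFn I) p‖ ≤ C * (R l)⁻¹ := fun I => by
      have := (hBound_iff.1 hf).2 (List.ofFn I) (by simpa using h2) p
      rwa [zero_add, List.length_ofFn, recipWeight_of_mem h1 h2] at this
    rw [nabla, PiLp.norm_eq_of_L2]
    calc √(∑ I : Fin l → Fin d, ‖𝒢.wordDeriv X f (List.ofFn I) p‖ ^ 2)
        ≤ √(∑ _I : Fin l → Fin d, (C * (R l)⁻¹) ^ 2) :=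
          Real.sqrt_le_sqrt (Finset.sum_le_sum fun I _ =>
            pow_le_pow_left₀ (norm_nonneg _) (h4 I) 2)
      _ = √(d ^ l) * (C * (R l)⁻¹) := by
          rw [Finset.sum_const, nsmul_eq_mul, Finset.card_univ, Fintype.card_fun, Fintype.card_fin,
            Fintype.card_fin, Real.sqrt_mul (by positivity), Real.sqrt_sq (by positivity)]
          push_cast; rfl
  calc ENNReal.ofReal (R l) * supNorm (𝒢.nabla X l f)
      ≤ ENNReal.ofReal (R l) * ENNReal.ofReal (√(d ^ l) * (C * (R l)⁻¹)) := by gcongr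
    _ = ENNReal.ofReal (√(d ^ l) * C) := by
        rw [← ENNReal.ofReal_mul hRl.le]
        congr 1
        field_simp

theorem HBound.of_weight_le {S S' : ℕ → ℝ} {k a : ℕ} {C C' : ℝ} (hf : 𝒢.HBound X S k a C f)
    (h : ∀ l ≤ k, C * S (a + l) ≤ C' * S' (a + l)) : 𝒢.HBound X S' k a C' f := by
  rw [hBound_iff] at hf ⊢
  exact ⟨hf.1, fun w hw p => (hf.2 w hw p).trans (h _ hw)⟩

theorem HBound.of_le {S : ℕ → ℝ} {k k' a : ℕ} {C : ℝ} (hk : k' ≤ k)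
    (hf : 𝒢.HBound X S k a C f) : 𝒢.HBound X S k' a C f := by
  induction k, hk using Nat.le_induction with
  | base => exact hf
  | succ k _ ih => exact ih hf.of_succ

end Seminorm

/-! ### Projection onto the orthogonal complement -/

section Projection

variable {F : Type*} [NormedAddCommGroup F] [InnerProductSpace ℝ F] {M : ℕ} {v : Fin M → F}

theorem inner_sub_sum_eq_zero (hv : Orthonormal ℝ v) (u : F) (i : Fin M) :
    inner ℝ (v i) (u - ∑ k, inner ℝ (v k) u • v k) = 0 := by
  rw [inner_sub_right, hv.inner_right_fintype, sub_self]

theorem inner_self_sub_sum (hv : Orthonormal ℝ v) (u : F) :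
    inner ℝ (u - ∑ k, inner ℝ (v k) u • v k) (u - ∑ k, inner ℝ (v k) u • v k) =
      inner ℝ u u - ∑ k, inner ℝ (v k) u ^ 2 := by
  have h : ∀ k, inner ℝ (v k) (u - ∑ k, inner ℝ (v k) u • v k) = 0 := inner_sub_sum_eq_zero hv u
  set z := u - ∑ k, inner ℝ (v k) u • v k with hz
  have h1 : inner ℝ z z = inner ℝ u z := by
    conv_lhs => rw [hz, inner_sub_left, sum_inner]
    simp only [← hz, inner_smul_left, h, mul_zero, Finset.sum_const_zero, sub_zero]
  rw [h1, hz, inner_sub_right, inner_sum]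
  simp only [inner_smul_right, sq, fun k => real_inner_comm u (v k)]

end Projection

/-! ### Adding one field -/

section ExtraField

variable {G : Type*} [NormedAddCommGroup G] [NormedSpace ℝ G] [FiniteDimensional ℝ G] [Group G]
  [LieGroup 𝓘(ℝ, G) ∞ G] (𝒢 : CarnotGroup G) {d : ℕ}
  (X : Module.Basis (Fin d) ℝ (𝒢.layer 1))

/-- One more unit vector field can be added to an orthonormal system. -/
theorem exists_orthogonal_unit_field [Nontrivial G] (M j : ℕ) (hj : 1 ≤ j) :
    ∃ C : ℝ, 0 ≤ C ∧ ∀ D : ℕ, M + 2 ^ (4 * 𝒢.hausdorffDim + 7) * 𝒢.hausdorffDim ≤ D →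
      ∀ R : ℕ → ℝ, (∀ i, 1 ≤ i → i ≤ j → 0 < R i) →
      (∀ i i', 1 ≤ i → 1 ≤ i' → i + i' ≤ j → R (i + i') ≤ R i * R i') →
      ∀ v : Fin M → G → EuclideanSpace ℝ (Fin D),
      (∀ i, 𝒢.HorizontalContDiff X j (v i)) →
      (∀ p, Orthonormal ℝ fun i => v i p) →
      (∀ i, 𝒢.weightedSeminorm X j R (v i) ≤ 1) →
      ∃ w : G → EuclideanSpace ℝ (Fin D), 𝒢.HorizontalContDiff X j w ∧ (∀ p, ‖w p‖ = 1) ∧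
        (∀ i p, inner ℝ (v i p) (w p) = 0) ∧ 𝒢.weightedSeminorm X j R w ≤ ENNReal.ofReal C ∧
        ∀ r : ℕ∞, (∀ i, ContDiff ℝ r (v i)) → ContDiff ℝ r w := by
  obtain ⟨A, Q, hA, hQ, hAQ⟩ := 𝒢.exists_field_almost_orthogonal X j
  -- Small enough that the projection onto the v_i takes away at most 1/2 of |u|², see `hεM`.
  set ε : ℝ := (1 + 2 * M * (Q * 4) ^ 2)⁻¹ with hε
  have hε0 : 0 < ε := by positivity
  have hε1 : ε ≤ 1 := inv_le_one_of_one_le₀ (le_add_of_nonneg_right (by positivity))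
  have hεM : M * (Q * (4 * ε)) ^ 2 ≤ 1 / 2 := by
    have h1 : ε * (1 + 2 * M * (Q * 4) ^ 2) = 1 := inv_mul_cancel₀ (by positivity)
    have h2 : M * (Q * (4 * ε)) ^ 2 = (ε * (2 * M * (Q * 4) ^ 2)) * ε / 2 := by ring
    have h3 : ε * (2 * M * (Q * 4) ^ 2) ≤ 1 := by linarith
    rw [h2]
    have h4 : ε * (2 * M * (Q * 4) ^ 2) * ε ≤ 1 := mul_le_one₀ h3 hε0.le hε1
    linarith
  set A' : ℝ := A * (ε⁻¹) ^ j with hA'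
  set C₀ : ℝ := A' + |(-1 : ℝ)| * (M * (2 ^ j * (2 ^ j * (1 * A') * 1))) with hC₀
  have hA'0 : 0 ≤ A' := by positivity
  have hC₀0 : 0 ≤ C₀ := by positivity
  obtain ⟨K, hK, hKf⟩ := exists_hBound_inv_sqrt 𝒢 X j (c := 1 / 2) (C := 2 ^ j * (C₀ * C₀))
    (by norm_num) (by positivity)
  refine ⟨∑ l ∈ Finset.Icc 1 j, √(d ^ l) * (2 ^ j * (K * C₀)), by positivity,
    fun D hD R hR hmul v hv hvo hvR => ?_⟩
  have hS := isWeight_recipWeight hR hmul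
  set S := recipWeight R j with hSdef
  have hS1 : S 1 = (R 1)⁻¹ := recipWeight_of_mem le_rfl hj
  have hR1 := hR 1 le_rfl hj
  have hv1 : ∀ i, 𝒢.HBound X S j 0 1 (v i) := fun i =>
    hBound_of_weightedSeminorm_le hR (hv i) (fun p => (hvo p).1 i) (hvR i)
  -- The v_i are Lipschitz with constant 1 / R 1, and a ball of radius 4 at unit scale has radius 4
  -- ε R 1 at the original scale; so they vary by at most 4 ε from its center.
  set s : ℝ := (ε * R 1)⁻¹ with hs
  have hs0 : 0 < s := by positivity
  obtain ⟨U, hU, hUA, hU1, hUQ⟩ := hAQ D M hD fun g i => v i (𝒢.dil s⁻¹ g)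
  let u : G → EuclideanSpace ℝ (Fin D) := fun p => U (𝒢.dil s p)
  have hu : ContDiff ℝ ∞ u := hU.comp (𝒢.dil s).contDiff
  have huA : 𝒢.HBound X S j 0 A' u := by
    have h1 := hUA.comp_dil hs0.le
    simp only [pow_zero, one_smul] at h1
    refine h1.of_weight_le fun l hl => ?_
    rw [zero_add, hA', mul_assoc]
    refine mul_le_mul_of_nonneg_left ?_ hA
    -- s ^ l = ε^(−l) · S 1 ^ l, where S 1 ^ l ≤ S l by submultiplicativity and ε^(−l) ≤ ε^(−j) is
    -- absorbed in `A'`.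
    rw [hs, mul_inv, mul_pow, ← hS1]
    exact mul_le_mul (pow_le_pow_right₀ ((one_le_inv₀ hε0).2 hε1) hl) (hS.pow_le hl)
      (pow_nonneg (hS.nonneg 1) l) (by positivity)
  have hinner : ∀ i p, |inner ℝ (v i p) (u p)| ≤ Q * (4 * ε) := by
    intro i p
    refine hUQ (𝒢.dil s p) (v i p) i (4 * ε) (by positivity) fun g hg => ?_
    have h1 := 𝒢.dil_mem_ccBall X (inv_nonneg.2 hs0.le) hg
    rw [dil_mul, dil_inv, 𝒢.dil_inv_dil hs0.ne'] at h1
    have h2 := (hv1 i).of_le hj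
    have h3 := norm_sub_le_of_mem_ccBall (hS.nonneg 1) (fun i' => (h2.2 i').1)
      (fun i' p => by simpa using (h2.2 i').2.norm_le p) (𝒢.dil s⁻¹ g) h1
    rw [mul_inv_cancel_left] at h3
    refine h3.trans_eq ?_
    rw [hS1, hs, inv_inv]
    field_simp
  let w₀ : G → EuclideanSpace ℝ (Fin D) := fun p => u p - ∑ i, inner ℝ (v i p) (u p) • v i p
  have hw₀ : 𝒢.HBound X S j 0 C₀ w₀ := by
    have h1 : ∀ i ∈ (Finset.univ : Finset (Fin M)), 𝒢.HBound X S j 0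
        (2 ^ j * (2 ^ j * (1 * A') * 1)) (fun p => inner ℝ (v i p) (u p) • v i p) := fun i _ =>
      ((hv1 i).inner hS zero_le_one hA'0 huA (by omega)).smul hS (by positivity) zero_le_one
        (hv1 i) (by omega)
    have h2 := huA.add ((HBound.sum Finset.univ hS h1).const_smul (-1))
    simp only [Finset.card_univ, Fintype.card_fin] at h2
    convert! h2 using 1
    funext p
    simp only [w₀, neg_smul, one_smul, sub_eq_add_neg]
  let f : G → ℝ := fun p => inner ℝ (w₀ p) (w₀ p)
  have hf : 𝒢.HBound X S j 0 (2 ^ j * (C₀ * C₀)) f :=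
    hw₀.inner hS hC₀0 hC₀0 hw₀ (by omega)
  have hf2 : ∀ p, 1 / 2 ≤ f p := by
    intro p
    have h1 : f p = inner ℝ (u p) (u p) - ∑ i, inner ℝ (v i p) (u p) ^ 2 :=
      inner_self_sub_sum (hvo p) (u p)
    have h2 : ∑ i, inner ℝ (v i p) (u p) ^ 2 ≤ ∑ _i : Fin M, (Q * (4 * ε)) ^ 2 :=
      Finset.sum_le_sum fun i _ => by
        rw [← sq_abs]; exact pow_le_pow_left₀ (abs_nonneg _) (hinner i p) 2
    rw [Finset.sum_const, nsmul_eq_mul, Finset.card_univ, Fintype.card_fin] at h2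
    have h3 : 1 ≤ inner ℝ (u p) (u p) := hU1 _
    linarith
  have hf0 : ∀ p, 0 < f p := fun p => lt_of_lt_of_le (by norm_num) (hf2 p)
  have hw : 𝒢.HBound X S j 0 (2 ^ j * (K * C₀)) (fun p => (√(f p))⁻¹ • w₀ p) :=
    (hKf S j hS le_rfl f hf hf2).smul hS hK hC₀0 hw₀ (by omega)
  refine ⟨fun p => (√(f p))⁻¹ • w₀ p, (hBound_iff.1 hw).1, fun p => ?_, fun i p => ?_,
    hw.weightedSeminorm_le hR (by positivity), fun r hr => ?_⟩
  · have h1 : √(f p) = ‖w₀ p‖ := (norm_eq_sqrt_real_inner (w₀ p)).symm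
    have h2 : w₀ p ≠ 0 := fun h => by
      have := hf0 p
      simp only [f, h, inner_zero_left, lt_irrefl] at this
    change ‖(√(f p))⁻¹ • w₀ p‖ = 1
    rw [h1]
    exact norm_smul_inv_norm h2
  · rw [inner_smul_right, inner_sub_sum_eq_zero (hvo p), mul_zero]
  · have hur : ContDiff ℝ r u := hu.of_le (WithTop.coe_le_coe.2 le_top)
    have hw₀r : ContDiff ℝ r w₀ :=
      hur.sub (ContDiff.sum fun i _ => ((hr i).inner ℝ hur).smul (hr i))
    have hfr : ContDiff ℝ r f := hw₀r.inner ℝ hw₀r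
    exact ((hfr.sqrt fun p => (hf0 p).ne').inv fun p => (Real.sqrt_pos.2 (hf0 p)).ne').smul hw₀r

end ExtraField

end CarnotGroup

namespace CarnotGroup

/-! ### Iteration: adding m' fields -/

section Extension

variable {G : Type*} [NormedAddCommGroup G] [NormedSpace ℝ G] [FiniteDimensional ℝ G] [Group G]
  [LieGroup 𝓘(ℝ, G) ∞ G] (𝒢 : CarnotGroup G) {d : ℕ}
  (X : Module.Basis (Fin d) ℝ (𝒢.layer 1))

theorem _root_.Orthonormal.snoc {F : Type*} [NormedAddCommGroup F] [InnerProductSpace ℝ F] {n : ℕ}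
    {f : Fin n → F} (hf : Orthonormal ℝ f) {x : F} (hx : ‖x‖ = 1) (h : ∀ i, inner ℝ (f i) x = 0) :
    Orthonormal ℝ (Fin.snoc f x : Fin (n + 1) → F) := by
  refine ⟨fun i => ?_, fun i k hik => ?_⟩
  · induction i using Fin.lastCases with
    | last => simpa using hx
    | cast i => simpa using hf.1 i
  · induction i using Fin.lastCases with
    | last =>
      induction k using Fin.lastCases with
      | last => exact absurd rfl hik
      | cast k => simpa [real_inner_comm] using h k
    | cast i =>
      induction k using Fin.lastCases with
      | last => simpa using h i
      | cast k => simpa using hf.2 (fun h => hik (by rw [h]))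

variable {𝒢 X} in
theorem weightedSeminorm_le_mul {F : Type*} [NormedAddCommGroup F] [NormedSpace ℝ F]
    {R R' : ℕ → ℝ} {j : ℕ} {c : ℝ} (hc : 0 ≤ c) (h : ∀ l, 1 ≤ l → l ≤ j → R' l ≤ c * R l)
    (f : G → F) :
    𝒢.weightedSeminorm X j R' f ≤ ENNReal.ofReal c * 𝒢.weightedSeminorm X j R f := by
  rw [weightedSeminorm, weightedSeminorm, Finset.mul_sum]
  refine Finset.sum_le_sum fun l hl => ?_
  obtain ⟨h1, h2⟩ := Finset.mem_Icc.1 hl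
  rw [← mul_assoc, ← ENNReal.ofReal_mul hc]
  gcongr
  exact h l h1 h2

/-- Induction on `m'`. The fields found so far satisfy the bound only with a constant c ≥ 1, so the
next one is constructed for the weights R l / c ^ l: these are still submultiplicative, they turn
the bound c into 1 because l ≥ 1, and going back to R costs at most c ^ j. The last field is added
to m + m' − 1 others, which explains `D + 1`. -/
theorem exists_orthonormal_extension [Nontrivial G] (m m' j : ℕ) (hj : 1 ≤ j) :
    ∃ C : ℝ, 0 ≤ C ∧ ∀ D : ℕ,
      m + m' + 2 ^ (4 * 𝒢.hausdorffDim + 7) * 𝒢.hausdorffDim ≤ D + 1 →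
      ∀ R : ℕ → ℝ, (∀ i, 1 ≤ i → i ≤ j → 0 < R i) →
      (∀ i i', 1 ≤ i → 1 ≤ i' → i + i' ≤ j → R (i + i') ≤ R i * R i') →
      ∀ v : Fin m → G → EuclideanSpace ℝ (Fin D),
      (∀ i, 𝒢.HorizontalContDiff X j (v i)) →
      (∀ p, Orthonormal ℝ fun i => v i p) →
      (∀ i, 𝒢.weightedSeminorm X j R (v i) ≤ 1) →
      ∃ w : Fin m' → G → EuclideanSpace ℝ (Fin D),
        (∀ i, 𝒢.HorizontalContDiff X j (w i)) ∧
        (∀ p, Orthonormal ℝ (Fin.append (fun i => v i p) (fun i => w i p))) ∧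
        (∀ i, 𝒢.weightedSeminorm X j R (w i) ≤ ENNReal.ofReal C) ∧
        (∀ r : ℕ∞, (∀ i, ContDiff ℝ r (v i)) → ∀ i, ContDiff ℝ r (w i)) := by
  induction m' with
  | zero =>
    refine ⟨0, le_rfl, fun D _ R _ _ v _ hvo _ => ⟨Fin.elim0, fun i => i.elim0, fun p => ?_,
      fun i => i.elim0, fun r _ i => i.elim0⟩⟩
    convert! hvo p using 1
    funext i
    exact Fin.append_left _ _ i
  | succ m' ih =>
    obtain ⟨C, hC, hext⟩ := ih
    obtain ⟨C', hC', hone⟩ := 𝒢.exists_orthogonal_unit_field X (m + m') j hj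
    set c : ℝ := max 1 C with hc
    have hc1 : 1 ≤ c := le_max_left _ _
    have hc0 : 0 < c := one_pos.trans_le hc1
    refine ⟨max C (c ^ j * C'), le_max_of_le_left hC, fun D hD R hR hmul v hv hvo hvR => ?_⟩
    obtain ⟨w, hw, hwo, hwR, hwr⟩ := hext D (by omega) R hR hmul v hv hvo hvR
    have hle : ∀ l, 1 ≤ l → l ≤ j → R l / c ^ l ≤ c⁻¹ * R l := fun l h1 h2 => by
      rw [div_eq_inv_mul]
      exact mul_le_mul_of_nonneg_right (inv_anti₀ hc0 (le_self_pow₀ hc1 (by omega)))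
        (hR l h1 h2).le
    have hge : ∀ l, 1 ≤ l → l ≤ j → R l ≤ c ^ j * (R l / c ^ l) := fun l h1 h2 => by
      have h3 : c ^ l ≤ c ^ j := pow_le_pow_right₀ hc1 h2
      have h4 : R l = c ^ l * (R l / c ^ l) := by field_simp
      have h5 : 0 ≤ R l / c ^ l := div_nonneg (hR l h1 h2).le (by positivity)
      exact h4.le.trans (mul_le_mul_of_nonneg_right h3 h5)
    have hsmall : ∀ f : G → EuclideanSpace ℝ (Fin D),
        𝒢.weightedSeminorm X j R f ≤ ENNReal.ofReal c →
        𝒢.weightedSeminorm X j (fun l => R l / c ^ l) f ≤ 1 := fun f hf => by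
      refine (weightedSeminorm_le_mul (inv_nonneg.2 hc0.le) hle f).trans ?_
      refine (mul_le_mul_right hf _).trans ?_
      rw [← ENNReal.ofReal_mul (inv_nonneg.2 hc0.le), inv_mul_cancel₀ hc0.ne', ENNReal.ofReal_one]
    have happ : ∀ p, (fun i => Fin.append v w i p) =
        Fin.append (fun i => v i p) (fun i => w i p) := fun p => by
      funext i
      induction i using Fin.addCases with
      | left i => simp only [Fin.append_left]
      | right i => simp only [Fin.append_right]
    obtain ⟨x, hx, hx1, hxo, hxR, hxr⟩ := hone D (by omega) (fun l => R l / c ^ l)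
      (fun i h1 h2 => div_pos (hR i h1 h2) (by positivity))
      (fun i i' h1 h2 h3 => by
        rw [div_mul_div_comm, ← pow_add]
        exact div_le_div_of_nonneg_right (hmul i i' h1 h2 h3) (by positivity))
      (Fin.append v w)
      (fun i => by
        induction i using Fin.addCases with
        | left i => rw [Fin.append_left]; exact hv i
        | right i => rw [Fin.append_right]; exact hw i)
      (fun p => by rw [happ]; exact hwo p)
      (fun i => hsmall _ (by
        induction i using Fin.addCases with
        | left i =>
          rw [Fin.append_left]
          exact (hvR i).trans (by simpa using ENNReal.ofReal_le_ofReal hc1)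
        | right i =>
          rw [Fin.append_right]
          exact (hwR i).trans (ENNReal.ofReal_le_ofReal (le_max_right _ _))))
    refine ⟨Fin.snoc w x, fun i => ?_, fun p => ?_, fun i => ?_, fun r hr i => ?_⟩
    · induction i using Fin.lastCases with
      | last => simpa using hx
      | cast i => simpa using hw i
    · have e : (fun i => (Fin.snoc w x : Fin (m' + 1) → G → EuclideanSpace ℝ (Fin D)) i p) =
          Fin.snoc (fun i => w i p) (x p) := by
        funext i
        induction i using Fin.lastCases with
        | last => simp
        | cast i => simp
      rw [e, Fin.append_snoc]
      refine (hwo p).snoc (hx1 p) fun i => ?_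
      rw [← happ]
      exact hxo i p
    · induction i using Fin.lastCases with
      | last =>
        rw [Fin.snoc_last]
        refine (weightedSeminorm_le_mul (by positivity) hge x).trans ?_
        refine (mul_le_mul_right hxR _).trans ?_
        rw [← ENNReal.ofReal_mul (by positivity)]
        exact ENNReal.ofReal_le_ofReal (le_max_right _ _)
      | cast i =>
        rw [Fin.snoc_castSucc]
        exact (hwR i).trans (ENNReal.ofReal_le_ofReal (le_max_left _ _))
    · induction i using Fin.lastCases with
      | last =>
        rw [Fin.snoc_last]
        refine hxr r fun i => ?_
        induction i using Fin.addCases with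
        | left i => rw [Fin.append_left]; exact hr i
        | right i => rw [Fin.append_right]; exact hwr r hr i
      | cast i => rw [Fin.snoc_castSucc]; exact hwr r hr i

end Extension

end CarnotGroup

theorem corollary4p5 {G : Type*} [NormedAddCommGroup G] [NormedSpace ℝ G]
    [FiniteDimensional ℝ G] [Nontrivial G] [Group G] [LieGroup 𝓘(ℝ, G) ∞ G]
    (𝒢 : CarnotGroup G) {d : ℕ} (X : Module.Basis (Fin d) ℝ (𝒢.layer 1))
    (m m' j : ℕ) (hm : 1 ≤ m) (hj : 1 ≤ j) :
    ∃ C : NNReal, ∀ (D : ℕ),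
      (m : ℤ) ≤ (D : ℤ) - 2 ^ (4 * 𝒢.hausdorffDim + 7) * (𝒢.hausdorffDim : ℤ) - (m' : ℤ) + 1 →
      ∀ R : ℕ → ℝ, (∀ i, 1 ≤ i → i ≤ j → 0 < R i) →
      (∀ i i', 1 ≤ i → 1 ≤ i' → i + i' ≤ j → R (i + i') ≤ R i * R i') →
      ∀ v : Fin m → G → EuclideanSpace ℝ (Fin D),
      (∀ i, 𝒢.HorizontalContDiff X j (v i)) →
      (∀ p, Orthonormal ℝ fun i => v i p) →
      (∀ i, 𝒢.weightedSeminorm X j R (v i) ≤ 1) →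
      ∃ w : Fin m' → G → EuclideanSpace ℝ (Fin D),
        (∀ i, 𝒢.HorizontalContDiff X j (w i)) ∧
        (∀ p, Orthonormal ℝ (Fin.append (fun i => v i p) (fun i => w i p))) ∧
        (∀ i, 𝒢.weightedSeminorm X j R (w i) ≤ C) ∧
        (∀ r : ℕ∞, (∀ i, ContDiff ℝ r (v i)) → ∀ i, ContDiff ℝ r (w i)) := by
  obtain ⟨C, -, hC⟩ := 𝒢.exists_orthonormal_extension X m m' j hj
  refine ⟨C.toNNReal, fun D hD => hC D ?_⟩
  -- Moving the subtracted terms to the other side lets the integer inequality be read in the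
  -- natural numbers.
  have h : (m : ℤ) + m' + 2 ^ (4 * 𝒢.hausdorffDim + 7) * 𝒢.hausdorffDim ≤ D + 1 := by linarith
  exact_mod_cast h
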